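/- A Dyck path of size $n\ge 0$ is a lattice path made of $n$ up-steps and $n$ down-steps, starting at height $0$ and whose height stays nonnegative. The Tamari order on Dyck paths of size $n$ is the reflexive transitive closure of the relation which relates $P=A\,d\,e\,B$ to the larger path $Q=A\,e\,d\,B$, where $d$ is a down-step followed by an up-step and $e$ is the shortest excursion following $d$ (a nonempty path staying strictly above its starting height except at its last point, where it returns to that height). Let $\mathcal I_n$ be the set of Tamari intervals of size $n$, i.e. of pairs $(P,Q)$ of Dyck paths of size $n$ with $P\le Q$. For $0\le i\le 2n$ let $P(i)$ be the height of $P$ at abscissa $i$, and let $\mathrm{contact}_{<i}(P)$ and $\mathrm{contact}_{\ge i}(P)$ be the numbers of abscissae $j\in\{0,\dots,2n\}$ with $P(j)=0$ and, respectively, $j<i$ or $j\ge i$. Consider the generating function $$G(x,y)\equiv G(t,x,y,w)=\sum_{n\ge 0}t^n\sum_{(P,Q)\in\mathcal I_n}\ \sum_{i=0}^{2n}w^{P(i)}x^{\mathrm{contact}_{<i}(P)}y^{\mathrm{contact}_{\ge i}(P)}\in\mathbb Q[x,y,w][[t]].$$ **Theorem.** The generating function $G(x,y)$ is algebraic, i.e.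 it is a root of a nonzero one-variable polynomial with coefficients in $\mathbb Q[t,x,y,w]$. Moreover, the series $h\in\mathbb Q[w][[z]]$ obtained from $G(1,1)\in\mathbb Q[w][[t]]$ by the change of variables $t=z(1-z)^3$ satisfies $C(h,z,w)=0$, where $$\begin{aligned}C(h,z,w)={}&wz(-1+z)^9h^3+(-1+z)^6(2w^2z^2-w^2z+2z^2+w-z)h^2\\&-(-1+z)^3(w^2z^3-3w^2z^2-2wz^3+w^2z-2wz^2+z^3+5wz-3z^2-2w+z)h\\&+4wz^2-4wz+w.\end{aligned}$$ -/

import Mathlib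

/-! Dyck paths are Mathlib's `DyckWord`s: lists of up-steps `U` and down-steps `D`, with as many `U`
as `D`, such that no prefix has more `D` than `U`. The size is `DyckWord.semilength`. -/

namespace TamariHeight

/-- The set of Dyck paths of size `n`. -/
abbrev DyckPath (n : ℕ) : Type := {p : DyckWord // p.semilength = n}

/-- `P(i)`: the height of the point of `P` at abscissa `i`, i.e. the number of up-steps minus the
number of down-steps among the first `i` steps (the subtraction never truncates). -/
def height (P : DyckWord) (i : ℕ) : ℕ :=
  (P.toList.take i).count DyckStep.U - (P.toList.take i).count DyckStep.D

/-- The elementary move of the Tamari order: `P = A d e B` and `Q = A e d B`, where `d` is a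
down-step and `e` is the shortest excursion following it, i.e. a nonempty path staying strictly
above its starting height, except at its end, where it returns to it (`DyckWord.IsNested`). -/
def TamariStep (P Q : DyckWord) : Prop :=
  ∃ (A B : List DyckStep) (e : DyckWord), e.IsNested ∧
    P.toList = A ++ [DyckStep.D] ++ e.toList ++ B ∧
    Q.toList = A ++ e.toList ++ [DyckStep.D] ++ B

/-- The Tamari order: reflexive transitive closure of the elementary moves. -/
def TamariLE (P Q : DyckWord) : Prop := Relation.ReflTransGen TamariStep P Q

open Classical in
/-- The set `𝓘ₙ` of Tamari intervals of size `n`. -/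
noncomputable def intervals (n : ℕ) : Finset (DyckPath n × DyckPath n) :=
  Finset.univ.filter fun I => TamariLE I.1.1 I.2.1

/-- Number of contacts (points of height `0`) of `P` at an abscissa `j < i`. -/
def contactLT (P : DyckWord) (i : ℕ) : ℕ :=
  ((Finset.range (2 * P.semilength + 1)).filter fun j => height P j = 0 ∧ j < i).card

/-- Number of contacts (points of height `0`) of `P` at an abscissa `j ≥ i`. -/
def contactGE (P : DyckWord) (i : ℕ) : ℕ :=
  ((Finset.range (2 * P.semilength + 1)).filter fun j => height P j = 0 ∧ i ≤ j).card

/-- `G(x,y) = G(t,x,y,w)`, as a formal power series in `t`, for `x`, `y`, `w` in any commutative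
ring (indeterminates or specializations of them): the sum over `n`, over the intervals `(P,Q)` of
size `n`, and over `0 ≤ i ≤ 2n`, of
`t^n * w^P(i) * x^(contacts of P before i) * y^(contacts of P from i on)`. -/
noncomputable def G {R : Type*} [CommRing R] (x y w : R) : PowerSeries R :=
  PowerSeries.mk fun n => ∑ I ∈ intervals n, ∑ i ∈ Finset.range (2 * n + 1),
    w ^ height I.1.1 i * x ^ contactLT I.1.1 i * y ^ contactGE I.1.1 i

/-- The change of variables `t = z(1-z)^3`, as a power series in `z`. -/
noncomputable def tOfZ (R : Type*) [CommRing R] : PowerSeries R :=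
  PowerSeries.X * (1 - PowerSeries.X) ^ 3

/-- The substitution `t = z(1-z)^3` is licit, as the constant term is zero. -/
theorem hasSubst_tOfZ (R : Type*) [CommRing R] : PowerSeries.HasSubst (tOfZ R) :=
  PowerSeries.HasSubst.of_constantCoeff_zero' (by simp [tOfZ])

/-- The cubic polynomial `C(h,z,w)`. -/
def cubic {R : Type*} [CommRing R] (h z w : R) : R :=
  w * z * (-1 + z) ^ 9 * h ^ 3
    + (-1 + z) ^ 6 * (2 * w ^ 2 * z ^ 2 - w ^ 2 * z + 2 * z ^ 2 + w - z) * h ^ 2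
    - (-1 + z) ^ 3 * (w ^ 2 * z ^ 3 - 3 * w ^ 2 * z ^ 2 - 2 * w * z ^ 3 + w ^ 2 * z
        - 2 * w * z ^ 2 + z ^ 3 + 5 * w * z - 3 * z ^ 2 - 2 * w + z) * h
    + 4 * w * z ^ 2 - 4 * w * z + w

end TamariHeight

/-!
The lower path of a nonempty interval `P ≤ U q₁ D q₂` decomposes uniquely as `P = U a D r p₂` with
`a r ≤ q₁` and `p₂ ≤ q₂` (`tamariLE_nest_add_iff`). Hence nonempty intervals are in bijection with
triples made of an interval, of a splitting of its lower path at a contact, and of a second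
interval (`sum_intervalPairs_succ`). Summing the weights over the splittings turns this bijection
into a functional equation with one catalytic variable for the generating function `F(x)` of
intervals (`F_equation`), where `x` counts the contacts other than the origin, and into a linear
equation with two catalytic variables for `G(x, y)` (`G_equation`), both over any commutative ring.

The equations are solved inside `R⟦X⟧`: a ring homomorphism `evalHom a` substitutes a series `a`
without constant term for `t`, so that `x` and `y` may be power series themselves, and the roots of
the kernels are found as fixed points of contracting maps. For `F`, the discriminant of the
quadratic equation has a double root `x₀`, which gives `F(1)` in terms of the series `Z` with
`t = Z(1-Z)³` (`exists_isParametrization`); then `F(x)` is rational in `Z` and `u`, where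
`x = (1+u)/(1+Zu)²` (`IsParametrization.evalF_eq`). For `G`, the kernel `x - 1 = t x² F(x) F(y)`
cancels `G(x, y)` and leaves a relation between `G(1, y)` and `G(1, 1)`
(`evalG_one_equation`). A second kernel `y - 1 = t w x y F(x) F(y)` cancels `G(1, y)`, so that
`G(1, 1) = x F(x) (F(y) - 1) + y F(y)` at the common root (`exists_evalG_one_one_eq`). In terms of
`s = 1 + Zv`, where `y = (1+v)/(1+Zv)²`, the first kernel equation factors and makes `x` rational in
`s` (`IsParametrization.kernel_eq`), the second one expresses `w` rationally in `Z` and `s`, and the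
cubic becomes an identity between rational functions (`cubic_eq_zero_of_param`).

For `t = z(1-z)³` one has `Z = z`, which is the second claim. For `t` itself, each of the series
`Z`, `F(x)`, `F(y)`, the kernel root, `G(1, 1)`, `G(1, y)` and `G(x, y)` is in turn a root of a
nonzero polynomial whose coefficients are algebraic, which is the first claim.
-/

namespace TamariHeight

open DyckStep

/-! ### Elementary moves and the first-return decomposition -/

theorem toList_add (p q : DyckWord) : (p + q).toList = p.toList ++ q.toList := rfl

theorem toList_nest_add (a b : DyckWord) :
    (a.nest + b).toList = U :: (a.toList ++ D :: b.toList) := by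
  simp [toList_add, DyckWord.nest]

/-- Every Dyck word is built from the empty word by the operation `(a, b) ↦ U a D b`. -/
theorem dyckWord_induction {C : DyckWord → Prop} (zero : C 0)
    (nest_add : ∀ a b, C a → C b → C (a.nest + b)) (p : DyckWord) : C p := by
  induction hn : p.semilength using Nat.strong_induction_on generalizing p with
  | _ n ih =>
    by_cases h : p = 0
    · rwa [h]
    · rw [← DyckWord.nest_insidePart_add_outsidePart h]
      exact nest_add _ _ (ih _ (hn ▸ DyckWord.semilength_insidePart_lt h) _ rfl)
        (ih _ (hn ▸ DyckWord.semilength_outsidePart_lt h) _ rfl)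

theorem exists_eq_nest_add {p : DyckWord} (h : p ≠ 0) : ∃ a b : DyckWord, p = a.nest + b :=
  ⟨_, _, (DyckWord.nest_insidePart_add_outsidePart h).symm⟩

theorem nest_add_ne_zero (a b : DyckWord) : a.nest + b ≠ 0 := by
  rw [← DyckWord.toList_ne_nil, toList_nest_add]
  simp

theorem nest_add_inj {a b a' b' : DyckWord} :
    a.nest + b = a'.nest + b' ↔ a = a' ∧ b = b' := by
  refine ⟨fun h => ?_, by rintro ⟨rfl, rfl⟩; rfl⟩
  have h1 := congrArg DyckWord.insidePart h
  have h2 := congrArg DyckWord.outsidePart h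
  simpa [DyckWord.insidePart_add, DyckWord.outsidePart_add] using And.intro h1 h2

theorem TamariStep.nest_add {a a' : DyckWord} (h : TamariStep a a') (b : DyckWord) :
    TamariStep (a.nest + b) (a'.nest + b) := by
  obtain ⟨A, B, e, he, h1, h2⟩ := h
  exact ⟨U :: A, B ++ D :: b.toList, e, he, by simp [toList_nest_add, h1],
    by simp [toList_nest_add, h2]⟩

theorem TamariStep.add_left {b b' : DyckWord} (h : TamariStep b b') (p : DyckWord) :
    TamariStep (p + b) (p + b') := by
  obtain ⟨A, B, e, he, h1, h2⟩ := h
  exact ⟨p.toList ++ A, B, e, he, by simp [toList_add, h1], by simp [toList_add, h2]⟩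

theorem TamariStep.add_right {p p' : DyckWord} (h : TamariStep p p') (b : DyckWord) :
    TamariStep (p + b) (p' + b) := by
  obtain ⟨A, B, e, he, h1, h2⟩ := h
  exact ⟨A, B ++ b.toList, e, he, by simp [toList_add, h1], by simp [toList_add, h2]⟩

/-- The elementary move `U a D U c D b → U a U c D D b`. -/
theorem tamariStep_absorb (a c b : DyckWord) :
    TamariStep (a.nest + (c.nest + b)) ((a + c.nest).nest + b) :=
  ⟨U :: a.toList, b.toList, c.nest, DyckWord.IsNested.nest, by
    rw [toList_nest_add]
    simp [toList_add], by
    rw [toList_nest_add]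
    simp [toList_add]⟩

theorem TamariStep.semilength_eq {p q : DyckWord} (h : TamariStep p q) :
    p.semilength = q.semilength := by
  obtain ⟨A, B, e, he, h1, h2⟩ := h
  simp only [DyckWord.semilength, h1, h2, List.count_append]
  ring

/-- An elementary move applied to a Dyck word gives a Dyck word. -/
theorem exists_dyckWord_of_move {p : DyckWord} {A B : List DyckStep} {e : DyckWord}
    (h : p.toList = A ++ [D] ++ e.toList ++ B) :
    ∃ q : DyckWord, q.toList = A ++ e.toList ++ [D] ++ B := by
  refine ⟨⟨_, ?_, fun i => ?_⟩, rfl⟩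
  · have := p.count_U_eq_count_D
    simp only [h, List.count_append] at this ⊢
    omega
  · have key := p.count_D_le_count_U
    rw [h] at key
    rcases le_total i A.length with h1 | h1
    · simpa [List.take_append, List.append_assoc, Nat.sub_eq_zero_of_le h1] using key i
    · obtain ⟨j, rfl⟩ := Nat.exists_eq_add_of_le h1
      rcases le_total j e.toList.length with h2 | h2
      · have := key (A.length + (j + 1))
        simp only [List.append_assoc, List.take_length_add_append, List.count_append,
          List.cons_append, List.nil_append, List.take_succ_cons, List.count_cons_self,
          List.take_append_of_le_length h2, List.count_cons_of_ne (show D ≠ U by decide)] at this ⊢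
        omega
      · obtain ⟨k, rfl⟩ := Nat.exists_eq_add_of_le h2
        rcases k with _ | k
        · have := key (A.length + (e.toList.length + 1))
          simp [List.append_assoc, List.take_length_add_append, List.count_append] at this ⊢
          omega
        · have := key (A.length + ((e.toList.length + k) + 1))
          simp only [List.append_assoc, List.take_length_add_append, List.count_append,
            List.cons_append, List.nil_append, List.take_succ_cons, List.count_cons_self,
            List.count_cons_of_ne (show D ≠ U by decide)] at this ⊢
          omega

/-- What follows a Dyck prefix of a Dyck word is a Dyck word. -/
theorem exists_eq_add_of_toList {p e : DyckWord} {B : List DyckStep}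
    (h : p.toList = e.toList ++ B) : ∃ b : DyckWord, b.toList = B ∧ p = e + b := by
  refine ⟨⟨B, ?_, fun i => ?_⟩, rfl, DyckWord.ext h⟩
  · have := p.count_U_eq_count_D
    have := e.count_U_eq_count_D
    simp only [h, List.count_append] at *
    omega
  · have := p.count_D_le_count_U (e.toList.length + i)
    have := e.count_U_eq_count_D
    simp only [h, List.take_length_add_append, List.count_append] at *
    omega

/-- The elementary moves from `U a D b` take place inside `a`, inside `b`, or move the first
excursion of `b` into `a`. -/
theorem TamariStep.cases_nest_add {a b q : DyckWord} (h : TamariStep (a.nest + b) q) :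
    (∃ a', TamariStep a a' ∧ q = a'.nest + b) ∨ (∃ b', TamariStep b b' ∧ q = a.nest + b') ∨
      ∃ c b' : DyckWord, b = c.nest + b' ∧ q = (a + c.nest).nest + b' := by
  obtain ⟨A, B, e, he, h1, h2⟩ := h
  rw [toList_nest_add] at h1
  rcases A with _ | ⟨x, A⟩
  · simp at h1
  simp only [List.cons_append, List.append_assoc, List.cons.injEq, List.nil_append] at h1 h2
  obtain ⟨rfl, h1⟩ := h1
  rcases List.append_eq_append_iff.1 h1 with ⟨C, hA, hb⟩ | ⟨C, ha, hb⟩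
  · rcases C with _ | ⟨y, C⟩
    · right; right
      simp only [List.nil_append, List.cons.injEq, true_and, List.append_nil] at hb hA
      obtain ⟨b', hb', rfl⟩ := exists_eq_add_of_toList hb
      refine ⟨e.denest he, b', by rw [DyckWord.nest_denest], DyckWord.ext ?_⟩
      rw [DyckWord.nest_denest, h2, toList_nest_add, toList_add, hA, hb']
      simp
    · right; left
      simp only [List.cons_append, List.cons.injEq] at hb
      obtain ⟨rfl, hb⟩ := hb
      have hb1 : b.toList = C ++ [D] ++ e.toList ++ B := by simpa using hb
      obtain ⟨b', hb'⟩ := exists_dyckWord_of_move hb1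
      refine ⟨b', ⟨C, B, e, he, hb1, hb'⟩, DyckWord.ext ?_⟩
      rw [h2, toList_nest_add, hb', hA]
      simp
  · rcases C with _ | ⟨y, C⟩
    · right; right
      simp only [List.nil_append, List.cons.injEq, true_and, List.append_nil] at hb ha
      obtain ⟨b', hb', rfl⟩ := exists_eq_add_of_toList hb.symm
      refine ⟨e.denest he, b', by rw [DyckWord.nest_denest], DyckWord.ext ?_⟩
      rw [DyckWord.nest_denest, h2, toList_nest_add, toList_add, ha, hb']
      simp
    · left
      simp only [List.cons_append, List.cons.injEq] at hb
      obtain ⟨rfl, hb⟩ := hb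
      -- The excursion cannot leave `a`: otherwise it would go below its starting height.
      have hC : ∃ B', C = e.toList ++ B' ∧ B = B' ++ D :: b.toList := by
        rcases List.append_eq_append_iff.1 hb with ⟨s, hs, hs'⟩ | ⟨s, hs, hs'⟩
        · exact ⟨s, hs, hs'⟩
        · rcases s with _ | ⟨y, s⟩
          · exact ⟨[], by simpa using hs.symm, by simpa using hs'.symm⟩
          · simp only [List.cons_append, List.cons.injEq] at hs'
            obtain ⟨rfl, -⟩ := hs'
            have i1 := e.count_D_le_count_U (C.length + 1)
            have i2 := a.count_D_le_count_U (A.length + 1)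
            have i3 := a.count_U_eq_count_D
            simp [hs, ha, List.take_append, List.take_of_length_le] at i1 i2 i3
            omega
      obtain ⟨B', rfl, rfl⟩ := hC
      have ha1 : a.toList = A ++ [D] ++ e.toList ++ B' := by simpa using ha
      obtain ⟨a', ha'⟩ := exists_dyckWord_of_move ha1
      refine ⟨a', ⟨A, B', e, he, ha1, ha'⟩, DyckWord.ext ?_⟩
      rw [h2, toList_nest_add, ha']
      simp

/-! ### Decomposition of Tamari intervals -/

theorem TamariLE.nest_add {a a' b b' : DyckWord} (ha : TamariLE a a') (hb : TamariLE b b') :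
    TamariLE (a.nest + b) (a'.nest + b') :=
  (Relation.ReflTransGen.lift (fun p : DyckWord => p.nest + b)
    (fun _ _ h => TamariStep.nest_add h b) _ _ ha).trans
    (Relation.ReflTransGen.lift (fun p => a'.nest + p)
      (fun _ _ h => TamariStep.add_left h _) _ _ hb)

theorem TamariLE.add {a a' b b' : DyckWord} (ha : TamariLE a a') (hb : TamariLE b b') :
    TamariLE (a + b) (a' + b') :=
  (Relation.ReflTransGen.lift (fun p => p + b) (fun _ _ h => TamariStep.add_right h b) _ _ ha).trans
    (Relation.ReflTransGen.lift (fun p => a' + p) (fun _ _ h => TamariStep.add_left h _) _ _ hb)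

theorem TamariLE.semilength_eq {p q : DyckWord} (h : TamariLE p q) :
    p.semilength = q.semilength := by
  induction h with
  | refl => rfl
  | tail _ h ih => exact ih.trans h.semilength_eq

/-- Moving the first down-step over the excursions of `r`, one at a time. -/
theorem tamariLE_absorb (a r b : DyckWord) :
    TamariLE (a.nest + (r + b)) ((a + r).nest + b) := by
  induction r using dyckWord_induction generalizing a with
  | zero => simp only [zero_add, add_zero]; exact Relation.ReflTransGen.refl
  | nest_add c r _ ih =>
    have h := ih (a + c.nest)
    rw [add_assoc] at h
    rw [add_assoc]
    exact Relation.ReflTransGen.head (tamariStep_absorb _ _ _) h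

/-- The recursive description of the intervals below `U q₁ D q₂`. -/
theorem tamariLE_nest_add_iff {p q₁ q₂ : DyckWord} :
    TamariLE p (q₁.nest + q₂) ↔
      ∃ a r p₂, p = a.nest + (r + p₂) ∧ TamariLE (a + r) q₁ ∧ TamariLE p₂ q₂ := by
  constructor
  · intro h
    induction hn : p.semilength using Nat.strong_induction_on generalizing p q₁ q₂ with
    | _ n ih =>
      generalize hq : q₁.nest + q₂ = q at h
      induction h generalizing q₁ q₂ with
      | refl => exact ⟨q₁, 0, q₂, by simp [hq], by rw [add_zero]; exact Relation.ReflTransGen.refl,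
          Relation.ReflTransGen.refl⟩
      | @tail q' q h1 h2 ih2 =>
        have hq' : q' ≠ 0 := by
          rintro rfl
          have := TamariStep.semilength_eq h2
          simp [← hq] at this
          omega
        obtain ⟨q₁', q₂', rfl⟩ := exists_eq_nest_add hq'
        obtain ⟨a, r, p₂, rfl, hle, hle₂⟩ := ih2 rfl
        rcases TamariStep.cases_nest_add h2 with ⟨a', ha', e⟩ | ⟨b', hb', e⟩ | ⟨c, b', rfl, e⟩
        · obtain ⟨rfl, rfl⟩ := nest_add_inj.1 (hq.trans e)
          exact ⟨a, r, p₂, rfl, hle.tail ha', hle₂⟩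
        · obtain ⟨rfl, rfl⟩ := nest_add_inj.1 (hq.trans e)
          exact ⟨a, r, p₂, rfl, hle, hle₂.tail hb'⟩
        · obtain ⟨rfl, rfl⟩ := nest_add_inj.1 (hq.trans e)
          have hlt : p₂.semilength < n := by
            simp at hn
            omega
          obtain ⟨a₂, r₂, p₃, rfl, hle', hle₃⟩ := ih _ hlt hle₂ rfl
          refine ⟨a, r + (a₂.nest + r₂), p₃, by simp only [add_assoc], ?_, hle₃⟩
          have h3 : TamariLE (a₂.nest + r₂) c.nest := by
            have h4 := (tamariLE_absorb a₂ r₂ 0).trans (hle'.nest_add Relation.ReflTransGen.refl)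
            rwa [add_zero, add_zero] at h4
          have h5 := TamariLE.add hle h3
          rwa [add_assoc] at h5
  · rintro ⟨a, r, p₂, rfl, h1, h2⟩
    exact (tamariLE_absorb a r p₂).trans (h1.nest_add h2)

/-! ### Heights and contacts along the first-return decomposition -/

@[simp] theorem height_zero (p : DyckWord) : height p 0 = 0 := by simp [height]

theorem height_nest_add_succ (a b : DyckWord) {i : ℕ} (hi : i < 2 * a.semilength + 1) :
    height (a.nest + b) (i + 1) = height a i + 1 := by
  have h1 : i ≤ a.toList.length := by
    rw [← DyckWord.two_mul_semilength_eq_length]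
    omega
  have := a.count_D_le_count_U i
  rw [height, toList_nest_add, List.take_succ_cons, List.take_append_of_le_length h1,
    List.count_cons_self, List.count_cons_of_ne (by decide), height]
  omega

theorem height_nest_add_shift (a b : DyckWord) (k : ℕ) :
    height (a.nest + b) (2 * a.semilength + 2 + k) = height b k := by
  have := a.count_U_eq_count_D
  rw [DyckWord.two_mul_semilength_eq_length,
    show a.toList.length + 2 + k = (a.toList.length + (k + 1)) + 1 by omega, height,
    toList_nest_add, List.take_succ_cons, List.take_length_add_append, List.take_succ_cons, height]
  simp only [List.count_cons_self, List.count_append, List.count_cons_of_ne (show D ≠ U by decide),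
    List.count_cons_of_ne (show U ≠ D by decide)]
  omega

/-- The points of `U a D b` are its origin, those of `a` and those of `b`. -/
theorem sum_range_nest_add {M : Type*} [AddCommMonoid M] (a b : DyckWord) (f : ℕ → M) :
    ∑ i ∈ Finset.range (2 * (a.nest + b).semilength + 1), f i =
      f 0 + ∑ i ∈ Finset.range (2 * a.semilength + 1), f (i + 1) +
        ∑ k ∈ Finset.range (2 * b.semilength + 1), f (2 * a.semilength + 2 + k) := by
  rw [DyckWord.semilength_add, DyckWord.semilength_nest,
    show 2 * (a.semilength + 1 + b.semilength) + 1 =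
      (2 * a.semilength + 1 + 1) + (2 * b.semilength + 1) by ring,
    Finset.sum_range_add, Finset.sum_range_succ' f, add_comm (f 0)]

/-- The contacts of `U a D b` are its origin and those of `b`. -/
theorem card_contacts_nest_add (a b : DyckWord) (s : ℕ → Prop) [DecidablePred s] :
    ((Finset.range (2 * (a.nest + b).semilength + 1)).filter
        fun j => height (a.nest + b) j = 0 ∧ s j).card =
      (if s 0 then 1 else 0) + ((Finset.range (2 * b.semilength + 1)).filter
        fun j => height b j = 0 ∧ s (2 * a.semilength + 2 + j)).card := by
  rw [Finset.card_filter, sum_range_nest_add, Finset.card_filter]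
  have h : ∑ i ∈ Finset.range (2 * a.semilength + 1),
      (if height (a.nest + b) (i + 1) = 0 ∧ s (i + 1) then 1 else 0) = 0 := by
    refine Finset.sum_eq_zero fun i hi => if_neg ?_
    rw [height_nest_add_succ a b (Finset.mem_range.1 hi)]
    simp
  simp only [h, add_zero, height_nest_add_shift, height_zero, true_and]

theorem contactLT_zero (p : DyckWord) : contactLT p 0 = 0 := by simp [contactLT]

theorem contactLT_nest_add_succ (a b : DyckWord) {i : ℕ} (hi : i < 2 * a.semilength + 1) :
    contactLT (a.nest + b) (i + 1) = 1 := by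
  rw [contactLT, card_contacts_nest_add a b (fun j => j < i + 1), if_pos i.succ_pos,
    Finset.card_eq_zero.2, add_zero]
  refine Finset.filter_eq_empty_iff.2 fun j _ => ?_
  omega

theorem contactLT_nest_add_shift (a b : DyckWord) (k : ℕ) :
    contactLT (a.nest + b) (2 * a.semilength + 2 + k) = 1 + contactLT b k := by
  rw [contactLT, card_contacts_nest_add a b (fun j => j < 2 * a.semilength + 2 + k),
    if_pos (by omega), contactLT]
  simp

theorem contactGE_nest_add_zero (a b : DyckWord) :
    contactGE (a.nest + b) 0 = 1 + contactGE b 0 := by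
  rw [contactGE, card_contacts_nest_add a b (fun j => 0 ≤ j), if_pos le_rfl, contactGE]
  simp

theorem contactGE_nest_add_succ (a b : DyckWord) {i : ℕ} (hi : i < 2 * a.semilength + 1) :
    contactGE (a.nest + b) (i + 1) = contactGE b 0 := by
  rw [contactGE, card_contacts_nest_add a b (fun j => i + 1 ≤ j), if_neg (by omega), contactGE,
    zero_add]
  congr 1
  refine Finset.filter_congr fun j _ => ?_
  have : i + 1 ≤ 2 * a.semilength + 2 + j := by omega
  simp [this, -DyckWord.two_mul_semilength_eq_length]

theorem contactGE_nest_add_shift (a b : DyckWord) (k : ℕ) :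
    contactGE (a.nest + b) (2 * a.semilength + 2 + k) = contactGE b k := by
  rw [contactGE, card_contacts_nest_add a b (fun j => 2 * a.semilength + 2 + k ≤ j),
    if_neg (by omega), contactGE]
  simp

/-- The number of returns to height `0`, i.e. the number of contacts other than the origin. -/
def returns (p : DyckWord) : ℕ := contactGE p 0 - 1

theorem contactGE_zero_right (p : DyckWord) : contactGE p 0 = returns p + 1 := by
  have : 0 < contactGE p 0 := Finset.card_pos.2 ⟨0, by simp⟩
  rw [returns]
  omega

@[simp] theorem returns_zero : returns 0 = 0 := by
  have : contactGE 0 0 ≤ 1 := (Finset.card_filter_le _ _).trans (by simp)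
  rw [returns]
  omega

@[simp] theorem returns_nest_add (a b : DyckWord) : returns (a.nest + b) = returns b + 1 := by
  have := contactGE_nest_add_zero a b
  rw [contactGE_zero_right, contactGE_zero_right] at this
  omega

@[simp] theorem returns_add (p q : DyckWord) : returns (p + q) = returns p + returns q := by
  induction p using dyckWord_induction with
  | zero => simp
  | nest_add a b _ ih =>
    rw [add_assoc, returns_nest_add, returns_nest_add, ih]
    ring

section PointSum

variable {R : Type*} [CommRing R] (x y w : R)

/-- The contribution of a lower path `p` to `G(x, y)`, i.e. the sum over its points. -/
def pointSum (p : DyckWord) : R :=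
  ∑ i ∈ Finset.range (2 * p.semilength + 1),
    w ^ height p i * x ^ contactLT p i * y ^ contactGE p i

@[simp] theorem pointSum_zero : pointSum x y w 0 = y := by
  simp [pointSum, contactGE_zero_right, contactLT_zero]

theorem pointSum_nest_add (a b : DyckWord) :
    pointSum x y w (a.nest + b) =
      (y ^ 2 + w * x * y * pointSum 1 1 w a) * y ^ returns b + x * pointSum x y w b := by
  rw [pointSum, sum_range_nest_add]
  congr 1
  · rw [height_zero, contactLT_zero, contactGE_nest_add_zero, contactGE_zero_right, pointSum,
      add_mul, Finset.mul_sum, Finset.sum_mul]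
    congr 1
    · ring
    · refine Finset.sum_congr rfl fun i hi => ?_
      rw [Finset.mem_range] at hi
      rw [height_nest_add_succ a b hi, contactLT_nest_add_succ a b hi,
        contactGE_nest_add_succ a b hi, contactGE_zero_right]
      ring
  · rw [pointSum, Finset.mul_sum]
    refine Finset.sum_congr rfl fun k _ => ?_
    rw [height_nest_add_shift, contactLT_nest_add_shift, contactGE_nest_add_shift]
    ring

theorem pointSum_add (p q : DyckWord) :
    pointSum x y w (p + q) = pointSum x y w p * y ^ returns q +
      x ^ returns p * (pointSum x y w q - y * y ^ returns q) := by
  induction p using dyckWord_induction with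
  | zero => simp
  | nest_add a b _ ih =>
    rw [add_assoc, pointSum_nest_add, pointSum_nest_add, ih, returns_add, returns_nest_add]
    ring

end PointSum

/-! ### Sums over the splittings of a path at a contact -/

theorem finite_splits (p : DyckWord) : {s : DyckWord × DyckWord | s.1 + s.2 = p}.Finite := by
  induction p using dyckWord_induction with
  | zero =>
    refine (Set.finite_singleton (0, 0)).subset ?_
    rintro ⟨a, r⟩ h
    simpa using h
  | nest_add c q _ ih =>
    refine ((ih.image fun s => (c.nest + s.1, s.2)).insert (0, c.nest + q)).subset ?_
    rintro ⟨a, r⟩ (h : a + r = _)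
    by_cases ha : a = 0
    · subst ha
      left
      simpa using h
    · right
      obtain ⟨c', q', rfl⟩ := exists_eq_nest_add ha
      rw [add_assoc, nest_add_inj] at h
      obtain ⟨rfl, rfl⟩ := h
      exact ⟨(q', r), rfl, rfl⟩

/-- The ways of splitting a Dyck path into two Dyck paths, one for each of its contacts. -/
noncomputable def splits (p : DyckWord) : Finset (DyckWord × DyckWord) := (finite_splits p).toFinset

@[simp] theorem mem_splits {p : DyckWord} {s : DyckWord × DyckWord} :
    s ∈ splits p ↔ s.1 + s.2 = p := by simp [splits]

section SplitSums

variable {M : Type*} [AddCommMonoid M]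

theorem sum_splits_zero (f : DyckWord × DyckWord → M) : ∑ s ∈ splits 0, f s = f (0, 0) := by
  rw [show splits 0 = {(0, 0)} by ext ⟨a, r⟩; simp, Finset.sum_singleton]

theorem sum_splits_nest_add (c q : DyckWord) (f : DyckWord × DyckWord → M) :
    ∑ s ∈ splits (c.nest + q), f s =
      f (0, c.nest + q) + ∑ s ∈ splits q, f (c.nest + s.1, s.2) := by
  classical
  have h : splits (c.nest + q) =
      insert (0, c.nest + q) ((splits q).image fun s => (c.nest + s.1, s.2)) := by
    ext ⟨a, r⟩
    simp only [mem_splits, Finset.mem_insert, Finset.mem_image, Prod.mk.injEq, Prod.exists]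
    constructor
    · intro h
      by_cases ha : a = 0
      · subst ha
        left
        simpa using h
      · right
        obtain ⟨c', q', rfl⟩ := exists_eq_nest_add ha
        rw [add_assoc, nest_add_inj] at h
        obtain ⟨rfl, rfl⟩ := h
        exact ⟨q', r, rfl, rfl, rfl⟩
    · rintro (⟨rfl, rfl⟩ | ⟨a', r', rfl, rfl, rfl⟩)
      · simp
      · simp [add_assoc]
  rw [h, Finset.sum_insert, Finset.sum_image]
  · rintro ⟨a, r⟩ _ ⟨a', r'⟩ _ h
    simpa using h
  · simp only [Finset.mem_image, Prod.mk.injEq, not_exists, not_and]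
    exact fun s _ h => absurd h (nest_add_ne_zero _ _)

variable {R : Type*} [CommRing R] (x y w : R)

/-- The weights of the right parts of the splittings form a geometric progression. -/
theorem sum_splits_returns (p : DyckWord) :
    (y - 1) * ∑ s ∈ splits p, y ^ returns s.2 = y ^ (returns p + 1) - 1 := by
  induction p using dyckWord_induction with
  | zero => simp [sum_splits_zero]
  | nest_add c q _ ih =>
    rw [sum_splits_nest_add, mul_add, ih, returns_nest_add]
    ring

/-- Sum over the splittings of a pointed path at a contact weakly after the marked point. -/
theorem sum_splits_pointSum_left (p : DyckWord) :
    (y - 1) * ∑ s ∈ splits p, pointSum 1 1 w s.1 * y ^ returns s.2 =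
      pointSum 1 y w p - pointSum 1 1 w p := by
  induction p using dyckWord_induction with
  | zero => simp [sum_splits_zero]
  | nest_add c q _ ih =>
    have h := sum_splits_returns y q
    have e : ∑ s ∈ splits q, pointSum 1 1 w (c.nest + s.1) * y ^ returns s.2 =
        (1 + w * pointSum 1 1 w c) * ∑ s ∈ splits q, y ^ returns s.2 +
          ∑ s ∈ splits q, pointSum 1 1 w s.1 * y ^ returns s.2 := by
      rw [Finset.mul_sum, ← Finset.sum_add_distrib]
      refine Finset.sum_congr rfl fun s _ => ?_
      rw [pointSum_nest_add]
      simp only [one_pow, mul_one, one_mul]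
      ring
    rw [sum_splits_nest_add, e]
    simp only [pointSum_nest_add, pointSum_zero, returns_nest_add, one_pow]
    linear_combination ih + (1 + w * pointSum 1 1 w c) * h

/-- Sum over the splittings of a pointed path at a contact weakly before the marked point. -/
theorem sum_splits_pointSum_right (p : DyckWord) :
    (x - 1) * (y - 1) * ∑ s ∈ splits p, pointSum x y w s.2 =
      (y - 1) * x * (pointSum x y w p - pointSum 1 y w p) +
        (x - 1) * y * (y ^ (returns p + 1) - 1) := by
  induction p using dyckWord_induction with
  | zero => simp [sum_splits_zero]; ring
  | nest_add c q _ ih =>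
    simp only [sum_splits_nest_add, pointSum_nest_add, returns_nest_add]
    linear_combination ih

end SplitSums

/-! ### The functional equations -/

/-- The Tamari intervals of size `n`, as pairs of Dyck words. -/
noncomputable def intervalPairs (n : ℕ) : Finset (DyckWord × DyckWord) :=
  (intervals n).map ((Function.Embedding.subtype _).prodMap (Function.Embedding.subtype _))

theorem mem_intervalPairs {n : ℕ} {I : DyckWord × DyckWord} :
    I ∈ intervalPairs n ↔ I.1.semilength = n ∧ TamariLE I.1 I.2 := by
  obtain ⟨p, q⟩ := I
  simp only [intervalPairs, intervals, Finset.mem_map, Finset.mem_filter, Finset.mem_univ, true_and]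
  constructor
  · rintro ⟨⟨⟨p', hp⟩, ⟨q', hq⟩⟩, h, e⟩
    simp only [Function.Embedding.coe_prodMap, Function.Embedding.subtype_apply, Prod.map_apply,
      Prod.mk.injEq] at e
    obtain ⟨rfl, rfl⟩ := e
    exact ⟨hp, h⟩
  · rintro ⟨hp, h⟩
    exact ⟨(⟨p, hp⟩, ⟨q, h.semilength_eq.symm.trans hp⟩), h, rfl⟩

theorem sum_intervals {M : Type*} [AddCommMonoid M] (n : ℕ) (f : DyckWord → M) :
    ∑ I ∈ intervals n, f I.1.1 = ∑ I ∈ intervalPairs n, f I.1 := by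
  rw [intervalPairs, Finset.sum_map]
  rfl

theorem sum_intervalPairs_zero {M : Type*} [AddCommMonoid M] (f : DyckWord → M) :
    ∑ I ∈ intervalPairs 0, f I.1 = f 0 := by
  have h : intervalPairs 0 = {(0, 0)} := by
    have h0 : ∀ p : DyckWord, p.semilength = 0 → p = 0 := fun p hp => by
      by_contra h
      obtain ⟨a, b, rfl⟩ := exists_eq_nest_add h
      simp at hp
    ext ⟨p, q⟩
    rw [mem_intervalPairs, Finset.mem_singleton, Prod.mk.injEq]
    constructor
    · rintro ⟨hp, h⟩
      exact ⟨h0 p hp, h0 q (h.semilength_eq.symm.trans hp)⟩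
    · rintro ⟨rfl, rfl⟩
      exact ⟨rfl, Relation.ReflTransGen.refl⟩
  rw [h, Finset.sum_singleton]

/-- A nonempty interval is made of an interval whose lower path is split at a contact, and of
a second interval. -/
theorem sum_intervalPairs_succ {M : Type*} [AddCommMonoid M] (n : ℕ) (f : DyckWord → M) :
    ∑ I ∈ intervalPairs (n + 1), f I.1 = ∑ ij ∈ Finset.HasAntidiagonal.antidiagonal n,
      ∑ I ∈ intervalPairs ij.1, ∑ J ∈ intervalPairs ij.2, ∑ s ∈ splits I.1,
        f (s.1.nest + (s.2 + J.1)) := by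
  simp_rw [Finset.sum_sigma']
  symm
  refine Finset.sum_bij
    (fun k _ => (k.2.2.2.1.nest + (k.2.2.2.2 + k.2.2.1.1), k.2.1.2.nest + k.2.2.1.2)) ?_ ?_ ?_ ?_
  · rintro ⟨⟨i, j⟩, ⟨p₁, q₁⟩, ⟨p₂, q₂⟩, ⟨a, r⟩⟩ h
    simp only [Finset.mem_sigma, Finset.HasAntidiagonal.mem_antidiagonal, mem_intervalPairs,
      mem_splits] at h ⊢
    obtain ⟨rfl, ⟨rfl, h1⟩, ⟨rfl, h2⟩, rfl⟩ := h
    refine ⟨?_, tamariLE_nest_add_iff.2 ⟨a, r, p₂, rfl, h1, h2⟩⟩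
    simp only [DyckWord.semilength_add, DyckWord.semilength_nest]
    ring
  · rintro ⟨⟨i, j⟩, ⟨p₁, q₁⟩, ⟨p₂, q₂⟩, ⟨a, r⟩⟩ h ⟨⟨i', j'⟩, ⟨p₁', q₁'⟩, ⟨p₂', q₂'⟩, ⟨a', r'⟩⟩ h' e
    simp only [Finset.mem_sigma, Finset.HasAntidiagonal.mem_antidiagonal, mem_intervalPairs,
      mem_splits] at h h'
    obtain ⟨-, ⟨rfl, h1⟩, ⟨rfl, h2⟩, rfl⟩ := h
    obtain ⟨-, ⟨rfl, h1'⟩, ⟨rfl, h2'⟩, rfl⟩ := h'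
    simp only [Prod.mk.injEq, nest_add_inj] at e
    obtain ⟨⟨rfl, e⟩, rfl, rfl⟩ := e
    -- The lengths of the upper paths tell where `r` ends in the lower path.
    have hl : r.semilength = r'.semilength := by
      have := h1.semilength_eq.trans h1'.semilength_eq.symm
      simpa using this
    have e' := congrArg DyckWord.toList e
    rw [toList_add, toList_add] at e'
    obtain ⟨e1, e2⟩ := List.append_inj e' (by
      rw [← DyckWord.two_mul_semilength_eq_length, ← DyckWord.two_mul_semilength_eq_length, hl])
    obtain rfl := DyckWord.ext e1
    obtain rfl := DyckWord.ext e2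
    rfl
  · rintro ⟨p, q⟩ h
    obtain ⟨hp, h⟩ := mem_intervalPairs.1 h
    have hq : q ≠ 0 := by
      rintro rfl
      have := h.semilength_eq
      simp [hp] at this
    obtain ⟨q₁, q₂, rfl⟩ := exists_eq_nest_add hq
    obtain ⟨a, r, p₂, rfl, h1, h2⟩ := tamariLE_nest_add_iff.1 h
    refine ⟨⟨((a + r).semilength, p₂.semilength), (a + r, q₁), (p₂, q₂), (a, r)⟩, ?_, rfl⟩
    simp only [Finset.mem_sigma, Finset.HasAntidiagonal.mem_antidiagonal, mem_intervalPairs,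
      mem_splits]
    refine ⟨?_, ⟨trivial, h1⟩, ⟨trivial, h2⟩, trivial⟩
    simp only [DyckWord.semilength_add, DyckWord.semilength_nest] at hp ⊢
    omega
  · intros
    rfl

section Series

open PowerSeries

variable {R : Type*} [CommRing R]

/-- The generating function of Tamari intervals counted by a weight `f` on their lower path. -/
noncomputable def series (f : DyckWord → R) : PowerSeries R :=
  PowerSeries.mk fun n => ∑ I ∈ intervalPairs n, f I.1

theorem G_eq_series (x y w : R) : G x y w = series (pointSum x y w) := by
  ext n
  rw [G, series, coeff_mk, coeff_mk, ← sum_intervals]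
  refine Finset.sum_congr rfl fun I _ => ?_
  rw [pointSum, I.1.2]

theorem series_add (f g : DyckWord → R) : series (fun p => f p + g p) = series f + series g := by
  ext n
  simp [series, Finset.sum_add_distrib]

theorem series_sub (f g : DyckWord → R) : series (fun p => f p - g p) = series f - series g := by
  ext n
  simp [series, Finset.sum_sub_distrib]

theorem series_mul_left (c : R) (f : DyckWord → R) :
    series (fun p => c * f p) = C c * series f := by
  ext n
  simp [series, Finset.mul_sum]

theorem series_mul_series (f g : DyckWord → R) :
    series f * series g = PowerSeries.mk fun n => ∑ ij ∈ Finset.HasAntidiagonal.antidiagonal n,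
      ∑ I ∈ intervalPairs ij.1, ∑ J ∈ intervalPairs ij.2, f I.1 * g J.1 := by
  ext n
  simp only [series, coeff_mul, coeff_mk, Finset.sum_mul_sum]

/-- If the weights of the paths `U a D r p₂`, with `a r = p₁`, sum to
`g₁ p₁ * g₂ p₂ + g₃ p₁ * g₄ p₂`, then the series satisfies the corresponding equation. -/
theorem series_eq (f g₁ g₂ g₃ g₄ : DyckWord → R)
    (h : ∀ p₁ p₂, ∑ s ∈ splits p₁, f (s.1.nest + (s.2 + p₂)) = g₁ p₁ * g₂ p₂ + g₃ p₁ * g₄ p₂) :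
    series f = C (f 0) + X * (series g₁ * series g₂ + series g₃ * series g₄) := by
  ext n
  rcases n with _ | n
  · simp [series, sum_intervalPairs_zero f]
  · rw [map_add, coeff_succ_X_mul, coeff_C, if_neg n.succ_ne_zero, zero_add, series_mul_series,
      series_mul_series, map_add, coeff_mk, coeff_mk, series, coeff_mk, sum_intervalPairs_succ,
      ← Finset.sum_add_distrib]
    simp_rw [h, Finset.sum_add_distrib]

/-- The generating function of Tamari intervals, where `x` counts the contacts of the lower path
other than the origin. -/
noncomputable def F (x : R) : PowerSeries R := series fun p => x ^ returns p

theorem series_pow_returns_succ (x : R) :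
    series (fun p => x ^ (returns p + 1) - 1) = C x * F x - F 1 := by
  rw [series_sub (fun p => x ^ (returns p + 1)) fun _ => 1, F, F, ← series_mul_left]
  simp only [pow_succ', one_pow]

/-- The functional equation for the series of intervals, with one catalytic variable. -/
theorem F_equation (x : R) :
    C (x - 1) * (F x - 1) = X * C x * (C x * F x - F 1) * F x := by
  have h := series_eq (fun p => (x - 1) * x ^ returns p)
    (fun p => x * (x ^ (returns p + 1) - 1)) (fun p => x ^ returns p) 0 0 (fun p₁ p₂ => by
      rw [← sum_splits_returns]
      simp only [returns_nest_add, Pi.zero_apply, mul_zero, add_zero, Finset.mul_sum,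
        Finset.sum_mul]
      refine Finset.sum_congr rfl fun s _ => ?_
      rw [returns_add]
      ring)
  have h0 : series (0 : DyckWord → R) = 0 := by
    ext n
    simp [series]
  rw [h0, series_mul_left, series_mul_left, series_pow_returns_succ] at h
  have h1 : series (fun p => x ^ returns p) = F x := rfl
  simp only [returns_zero, pow_zero, mul_one, h1] at h
  linear_combination h

/-- The functional equation for the series of pointed intervals, with two catalytic variables. -/
theorem G_equation (x y w : R) :
    C ((x - 1) * (y - 1)) * (G x y w - C y) =
      X * ((C ((x - 1) * y ^ 2) * (C y * F y - F 1) +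
          C (w * x * y * (x - 1)) * (G 1 y w - G 1 1 w) +
          C x * (C ((y - 1) * x) * (G x y w - G 1 y w) +
            C ((x - 1) * y) * (C y * F y - F 1))) * F y +
        C (x * (y - 1)) * (C x * F x - F 1) * (G x y w - C y * F y)) := by
  have h := series_eq (fun p => (x - 1) * (y - 1) * pointSum x y w p)
    (fun p => (x - 1) * y ^ 2 * (y ^ (returns p + 1) - 1) +
      w * x * y * (x - 1) * (pointSum 1 y w p - pointSum 1 1 w p) +
      x * ((y - 1) * x * (pointSum x y w p - pointSum 1 y w p) +
        (x - 1) * y * (y ^ (returns p + 1) - 1)))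
    (fun p => y ^ returns p)
    (fun p => x * (y - 1) * (x ^ (returns p + 1) - 1))
    (fun p => pointSum x y w p - y * y ^ returns p) (fun p₁ p₂ => by
      have e : ∀ s : DyckWord × DyckWord, pointSum x y w (s.1.nest + (s.2 + p₂)) =
          y ^ 2 * y ^ returns p₂ * y ^ returns s.2 +
          w * x * y * y ^ returns p₂ * (pointSum 1 1 w s.1 * y ^ returns s.2) +
          x * y ^ returns p₂ * pointSum x y w s.2 +
          x * (pointSum x y w p₂ - y * y ^ returns p₂) * x ^ returns s.2 := fun s => by
        rw [pointSum_nest_add, pointSum_add, returns_add]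
        ring
      rw [← Finset.mul_sum]
      simp only [e, Finset.sum_add_distrib, ← Finset.mul_sum]
      linear_combination (x - 1) * y ^ 2 * y ^ returns p₂ * sum_splits_returns y p₁ +
        (x - 1) * w * x * y * y ^ returns p₂ * sum_splits_pointSum_left y w p₁ +
        x * y ^ returns p₂ * sum_splits_pointSum_right x y w p₁ +
        (y - 1) * x * (pointSum x y w p₂ - y * y ^ returns p₂) * sum_splits_returns x p₁)
  have h1 : ∀ z : R, series (fun p => z * z ^ returns p) = C z * F z := fun z => series_mul_left _ _
  simp only [series_add, series_mul_left, series_sub (pointSum x y w), h1,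
    series_sub (pointSum 1 y w), series_pow_returns_succ, ← G_eq_series, pointSum_zero] at h
  have h2 : series (fun p => y ^ returns p) = F y := rfl
  rw [h2] at h
  simp only [map_mul, map_sub, map_pow, map_one] at h ⊢
  linear_combination h

end Series

open PowerSeries

/-! ### Evaluation of a power series at a power series without constant term -/

section Evaluation

variable {R : Type*} [CommRing R]

open PowerSeries.WithPiTopology in
/-- A series without constant term is topologically nilpotent for the `X`-adic topology, so power
series can be evaluated at it. -/
theorem exists_evalHom (a : R⟦X⟧) (ha : constantCoeff a = 0) :
    ∃ φ : R⟦X⟧⟦X⟧ →+* R⟦X⟧, φ X = a ∧ ∀ s, φ (C s) = s := by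
  let _ : UniformSpace R := ⊥
  have _ : DiscreteUniformity R := ⟨rfl⟩
  have h : HasEval a := by
    rw [hasEval_def]
    exact isTopologicallyNilpotent_of_constantCoeff_zero ha
  refine ⟨eval₂Hom (φ := RingHom.id R⟦X⟧) continuous_id h, ?_, fun s => ?_⟩
  · rw [coe_eval₂Hom, eval₂_X]
  · rw [coe_eval₂Hom, eval₂_C, RingHom.id_apply]

/-- Evaluation at `t = a` of a power series in `t` with coefficients in `R⟦X⟧`, where `a` has no
constant term. -/
noncomputable def evalHom (a : R⟦X⟧) (ha : constantCoeff a = 0) : R⟦X⟧⟦X⟧ →+* R⟦X⟧ :=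
  (exists_evalHom a ha).choose

theorem evalHom_X (a : R⟦X⟧) (ha : constantCoeff a = 0) : evalHom a ha X = a :=
  (exists_evalHom a ha).choose_spec.1

theorem evalHom_C (a : R⟦X⟧) (ha : constantCoeff a = 0) (s : R⟦X⟧) : evalHom a ha (C s) = s :=
  (exists_evalHom a ha).choose_spec.2 s

theorem eq_zero_of_forall_X_pow_dvd {s : R⟦X⟧} (h : ∀ n, X ^ n ∣ s) : s = 0 := by
  ext n
  exact X_pow_dvd_iff.1 (h (n + 1)) n n.lt_succ_self

/-- On series with constant coefficients, evaluation at `a` is Mathlib's substitution. -/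
theorem evalHom_map_C (a : R⟦X⟧) (ha : constantCoeff a = 0) (f : R⟦X⟧) :
    evalHom a ha (PowerSeries.map C f) = f.subst a := by
  have hs := HasSubst.of_constantCoeff_zero' ha
  have hX : X ∣ a := X_dvd_iff.2 ha
  -- Both sides agree with a polynomial in `a` up to any power of `X`.
  refine sub_eq_zero.1 (eq_zero_of_forall_X_pow_dvd fun n => ?_)
  induction n generalizing f with
  | zero => simp
  | succ n ih =>
    have hC : (C (constantCoeff f)).subst a = C (constantCoeff f) := by
      have := subst_coe hs (Polynomial.C (constantCoeff f))
      simpa using this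
    obtain ⟨g, hg⟩ : ∃ g, f = C (constantCoeff f) + X * g :=
      ⟨_, by rw [add_comm]; exact eq_X_mul_shift_add_const f⟩
    have h1 : evalHom a ha (PowerSeries.map C f) - f.subst a =
        a * (evalHom a ha (PowerSeries.map C g) - g.subst a) := by
      rw [hg, ← coe_substAlgHom hs]
      simp only [map_add, map_mul, map_C, map_X, evalHom_X, evalHom_C]
      rw [coe_substAlgHom hs, subst_X hs, hC]
      ring
    rw [h1, pow_succ']
    exact mul_dvd_mul hX (ih g)

theorem dvd_evalHom (a : R⟦X⟧) (ha : constantCoeff a = 0) (d : R⟦X⟧) (f : R⟦X⟧⟦X⟧)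
    (h : ∀ n, d ∣ coeff n f) : d ∣ evalHom a ha f := by
  choose g hg using h
  have : f = C d * PowerSeries.mk g := by
    ext1 n
    rw [coeff_C_mul, coeff_mk, hg]
  rw [this, map_mul, evalHom_C]
  exact dvd_mul_right _ _

end Evaluation

/-! ### Fixed points of contracting maps of `R⟦X⟧` -/

section FixedPoint

variable {R : Type*} [CommRing R]

/-- Maps that preserve all congruences. -/
def CongrPreserving (g : R⟦X⟧ → R⟦X⟧) : Prop := ∀ x x', x - x' ∣ g x - g x'

theorem CongrPreserving.const (c : R⟦X⟧) : CongrPreserving fun _ => c := fun x x' => by simp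

theorem CongrPreserving.id : CongrPreserving fun x : R⟦X⟧ => x := fun _ _ => dvd_rfl

theorem CongrPreserving.add {f g : R⟦X⟧ → R⟦X⟧} (hf : CongrPreserving f) (hg : CongrPreserving g) :
    CongrPreserving fun x => f x + g x := fun x x' => by
  rw [add_sub_add_comm]
  exact dvd_add (hf x x') (hg x x')

theorem CongrPreserving.mul {f g : R⟦X⟧ → R⟦X⟧} (hf : CongrPreserving f) (hg : CongrPreserving g) :
    CongrPreserving fun x => f x * g x := fun x x' => by
  have : f x * g x - f x' * g x' = (f x - f x') * g x + f x' * (g x - g x') := by ring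
  rw [this]
  exact dvd_add ((hf x x').mul_right _) ((hg x x').mul_left _)

theorem CongrPreserving.comp {f g : R⟦X⟧ → R⟦X⟧} (hf : CongrPreserving f) (hg : CongrPreserving g) :
    CongrPreserving fun x => f (g x) := fun x x' => (hg x x').trans (hf _ _)

/-- The map `x ↦ c + a g(x)` is contracting for the `X`-adic topology, as `X` divides `a`. -/
theorem exists_fixedPoint (c a : R⟦X⟧) (ha : constantCoeff a = 0) {g : R⟦X⟧ → R⟦X⟧}
    (hg : CongrPreserving g) : ∃ x, x = c + a * g x := by
  have hX : X ∣ a := X_dvd_iff.2 ha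
  set f : R⟦X⟧ → R⟦X⟧ := fun x => c + a * g x with hf
  have hstep : ∀ n x x', X ^ n ∣ x - x' → X ^ (n + 1) ∣ f x - f x' := fun n x x' h => by
    rw [hf, pow_succ']
    simp only [add_sub_add_left_eq_sub, ← mul_sub]
    exact mul_dvd_mul hX (h.trans (hg x x'))
  set u : ℕ → R⟦X⟧ := fun n => f^[n] 0 with hu
  have hu_succ : ∀ n, u (n + 1) = f (u n) := fun n => Function.iterate_succ_apply' f n 0
  have h1 : ∀ n, X ^ n ∣ u (n + 1) - u n := fun n => by
    induction n with
    | zero => simp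
    | succ n ih =>
      rw [hu_succ (n + 1), hu_succ n]
      exact hstep n _ _ (hu_succ n ▸ ih)
  have h2 : ∀ n k, X ^ n ∣ u (n + k) - u n := fun n k => by
    induction k with
    | zero => simp
    | succ k ih =>
      have := dvd_add ((pow_dvd_pow X (Nat.le_add_right n k)).trans (h1 (n + k))) ih
      rwa [sub_add_sub_cancel] at this
  let x : R⟦X⟧ := PowerSeries.mk fun n => coeff n (u (n + 1))
  have hx : ∀ n, X ^ n ∣ x - u n := fun n => by
    rw [X_pow_dvd_iff]
    intro m hm
    obtain ⟨k, rfl⟩ := Nat.exists_eq_add_of_le (Nat.succ_le_of_lt hm)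
    have := X_pow_dvd_iff.1 (h2 (m + 1) k) m m.lt_succ_self
    rw [map_sub, sub_eq_zero] at this
    rw [map_sub, coeff_mk, ← this, sub_self]
  refine ⟨x, sub_eq_zero.1 (eq_zero_of_forall_X_pow_dvd fun n => ?_)⟩
  have h3 : X ^ (n + 1) ∣ f x - u (n + 1) := by
    rw [hu_succ]
    exact hstep n _ _ (hx n)
  have := dvd_sub (hx (n + 1)) h3
  rw [sub_sub_sub_cancel_right] at this
  exact (pow_dvd_pow X n.le_succ).trans this

theorem isUnit_one_add_mul (a : R⟦X⟧) (ha : constantCoeff a = 0) (k : R⟦X⟧) :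
    IsUnit (1 + a * k) := by
  rw [isUnit_iff_constantCoeff]
  simp [ha]

/-- Solution of a fixed point equation depending on a parameter. -/
theorem exists_fixedPoint_param (c a : R⟦X⟧) (ha : constantCoeff a = 0) {g k : R⟦X⟧ → R⟦X⟧}
    (hg : CongrPreserving g) (hk : CongrPreserving k) :
    ∃ ξ : R⟦X⟧ → R⟦X⟧, CongrPreserving ξ ∧ ∀ y, ξ y = c + a * (g (ξ y) * k y) := by
  have h : ∀ y, ∃ x, x = c + a * (g x * k y) := fun y =>
    exists_fixedPoint c a ha (hg.mul (CongrPreserving.const (k y)))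
  choose ξ hξ using h
  refine ⟨ξ, fun y y' => ?_, hξ⟩
  obtain ⟨p, hp⟩ := hg (ξ y) (ξ y')
  obtain ⟨q, hq⟩ := hk y y'
  obtain ⟨e, he⟩ := isUnit_one_add_mul a ha (-(p * k y))
  have key : (1 + a * -(p * k y)) * (ξ y - ξ y') = (y - y') * (a * (g (ξ y') * q)) := by
    linear_combination hξ y - hξ y' + a * k y * hp + a * g (ξ y') * hq
  rw [← he] at key
  exact Units.dvd_mul_left.1 (Dvd.intro _ key.symm)

end FixedPoint

/-! ### The functional equations at power series -/

section Evaluated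

variable {R : Type*} [CommRing R] (a : R⟦X⟧) (ha : constantCoeff a = 0)

/-- The series `F(x)` at `t = a`, where `x` may be a power series. -/
noncomputable def evalF (x : R⟦X⟧) : R⟦X⟧ := evalHom a ha (F x)

/-- The series `G(x, y)` at `t = a`, where `x`, `y` and `w` may be power series. -/
noncomputable def evalG (x y w : R⟦X⟧) : R⟦X⟧ := evalHom a ha (G x y w)

theorem evalF_equation (x : R⟦X⟧) :
    (x - 1) * (evalF a ha x - 1) =
      a * x * (x * evalF a ha x - evalF a ha 1) * evalF a ha x := by
  simpa [evalF, evalHom_C, evalHom_X] using congrArg (evalHom a ha) (F_equation x)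

theorem evalG_equation (x y w : R⟦X⟧) :
    (x - 1) * (y - 1) * (evalG a ha x y w - y) =
      a * (((x - 1) * y ^ 2 * (y * evalF a ha y - evalF a ha 1) +
          w * x * y * (x - 1) * (evalG a ha 1 y w - evalG a ha 1 1 w) +
          x * ((y - 1) * x * (evalG a ha x y w - evalG a ha 1 y w) +
            (x - 1) * y * (y * evalF a ha y - evalF a ha 1))) * evalF a ha y +
        x * (y - 1) * (x * evalF a ha x - evalF a ha 1) *
          (evalG a ha x y w - y * evalF a ha y)) := by
  have h := congrArg (evalHom a ha) (G_equation x y w)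
  simp only [map_mul, map_add, map_sub, map_pow, map_one, evalHom_C, evalHom_X] at h
  simp only [evalG, evalF]
  linear_combination h

/-- A form of the functional equation for `G` in which the kernel appears. -/
theorem evalG_kernel_equation (x y w : R⟦X⟧) :
    (y - 1) * (x - 1 - a * x ^ 2 * evalF a ha x * evalF a ha y) * evalG a ha x y w =
      (x - 1) * (y - 1) * (x * evalF a ha x * (evalF a ha y - 1) + y * evalF a ha y) +
      a * w * x * y * (x - 1) * evalF a ha x * evalF a ha y *
        (evalG a ha 1 y w - evalG a ha 1 1 w) -
      a * x ^ 2 * (y - 1) * evalF a ha x * evalF a ha y * evalG a ha 1 y w := by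
  linear_combination evalF a ha x * evalG_equation a ha x y w +
    (y - 1) * (y * evalF a ha y - evalG a ha x y w) * evalF_equation a ha x -
    (x - 1) * evalF a ha x * (y + x) * evalF_equation a ha y

/-- The coefficients of `F(x)` are polynomials in `x`. -/
theorem congrPreserving_evalF : CongrPreserving (evalF a ha) := fun x x' => by
  rw [evalF, evalF, ← map_sub]
  refine dvd_evalHom a ha _ _ fun n => ?_
  rw [map_sub, F, F, series, series, coeff_mk, coeff_mk, ← Finset.sum_sub_distrib]
  exact Finset.dvd_sum fun I _ => sub_dvd_pow_sub_pow _ _ _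

theorem exists_evalF_eq (x : R⟦X⟧) : ∃ k, evalF a ha x = 1 + a * k := by
  obtain ⟨g, hg⟩ : ∃ g, F x = C (constantCoeff (F x)) + X * g :=
    ⟨_, by rw [add_comm]; exact eq_X_mul_shift_add_const (F x)⟩
  have h0 : constantCoeff (F x) = 1 := by
    rw [← coeff_zero_eq_constantCoeff_apply, F, series, coeff_mk,
      sum_intervalPairs_zero fun p => x ^ returns p, returns_zero, pow_zero]
  refine ⟨evalHom a ha g, ?_⟩
  rw [evalF, hg, h0, map_add, map_mul, evalHom_C, evalHom_X]

@[simp] theorem constantCoeff_evalF (x : R⟦X⟧) : constantCoeff (evalF a ha x) = 1 := by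
  obtain ⟨k, hk⟩ := exists_evalF_eq a ha x
  simp [hk, ha]

end Evaluated

/-! ### The number of intervals -/

section Solution

variable {R : Type*} [CommRing R] (a : R⟦X⟧) (ha : constantCoeff a = 0)

theorem ne_zero_of_constantCoeff {s : R⟦X⟧} (h : constantCoeff s ≠ 0) : s ≠ 0 := by
  rintro rfl
  simp at h

/-- The discriminant of the quadratic equation satisfied by `F(x)`. -/
noncomputable def disc (x : R⟦X⟧) : R⟦X⟧ :=
  (x - 1 + a * x * evalF a ha 1) ^ 2 - 4 * a * x ^ 2 * (x - 1)

/-- The square root of the discriminant given by `F(x)`. -/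
noncomputable def discRoot (x : R⟦X⟧) : R⟦X⟧ :=
  2 * a * x ^ 2 * evalF a ha x - (x - 1) - a * x * evalF a ha 1

theorem discRoot_sq (x : R⟦X⟧) : discRoot a ha x ^ 2 = disc a ha x := by
  rw [discRoot, disc]
  linear_combination (-4 * a * x ^ 2) * evalF_equation a ha x

/-- The square root of the discriminant vanishes at some `x₀`, and its quotient by `x - x₀` has
constant term `-1`. -/
theorem exists_discRoot_eq_zero : ∃ x₀ : R⟦X⟧, constantCoeff x₀ = 1 ∧ discRoot a ha x₀ = 0 ∧
    ∀ x, ∃ k, discRoot a ha x = (x - x₀) * (-1 + a * k) := by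
  have hg : CongrPreserving fun x => 2 * (x * (x * evalF a ha x)) + -evalF a ha 1 * x :=
    ((CongrPreserving.const 2).mul (CongrPreserving.id.mul
      (CongrPreserving.id.mul (congrPreserving_evalF a ha)))).add
      ((CongrPreserving.const _).mul CongrPreserving.id)
  obtain ⟨x₀, h⟩ := exists_fixedPoint 1 a ha hg
  have h0 : discRoot a ha x₀ = 0 := by
    rw [discRoot]
    linear_combination -h
  refine ⟨x₀, ?_, h0, fun x => ?_⟩
  · rw [h]
    simp [ha]
  · obtain ⟨k, hk⟩ := hg x x₀
    refine ⟨k, ?_⟩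
    have e : discRoot a ha x = discRoot a ha x - discRoot a ha x₀ := by rw [h0, sub_zero]
    rw [e, discRoot, discRoot]
    linear_combination a * hk

variable [CharZero R]

theorem two_ne_zero_powerSeries : (2 : R⟦X⟧) ≠ 0 := fun h => by
  have := congrArg (constantCoeff (R := R)) h
  rw [map_ofNat, map_zero] at this
  exact two_ne_zero this

/-- The data attached to `t = a`: the series `Z` such that `t = Z(1-Z)³`, and the double root `x₀`
of the discriminant. -/
structure IsParametrization (Z x₀ : R⟦X⟧) : Prop where
  constantCoeff_eq : constantCoeff Z = 0
  ne_zero : Z ≠ 0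
  eq : a = Z * (1 - Z) ^ 3
  evalF_one : evalF a ha 1 * (1 - Z) ^ 3 = 1 - 2 * Z
  mul_eq_one : (1 - Z) * x₀ = 1
  root_eq : a * x₀ ^ 4 = x₀ - 1
  discRoot_eq : ∀ x, ∃ k, discRoot a ha x = (x - x₀) * (-1 + a * k)

variable [IsDomain R]

/-- The discriminant has a double root, which determines `F(1)`. -/
theorem exists_isParametrization (ha0 : a ≠ 0) : ∃ Z x₀ : R⟦X⟧, IsParametrization a ha Z x₀ := by
  obtain ⟨x₀, hc, h0, hk⟩ := exists_discRoot_eq_zero a ha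
  have hx0 : x₀ ≠ 0 := ne_zero_of_constantCoeff (by rw [hc]; exact one_ne_zero)
  have h2 := two_ne_zero_powerSeries (R := R)
  set f := evalF a ha 1 with hf
  have hd0 : disc a ha x₀ = 0 := by rw [← discRoot_sq, h0, zero_pow two_ne_zero]
  have hd1 : 2 * (x₀ - 1 + a * x₀ * f) * (1 + a * f) -
      8 * a * x₀ * (x₀ - 1) - 4 * a * x₀ ^ 2 = 0 := by
    refine eq_zero_of_forall_X_pow_dvd fun n => ?_
    obtain ⟨k, hk⟩ := hk (x₀ + X ^ n)
    have h := discRoot_sq a ha (x₀ + X ^ n)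
    have h3 := hd0
    rw [hk, disc, ← hf] at h
    rw [disc, ← hf] at h3
    have hX : (X : R⟦X⟧) ^ n ≠ 0 := pow_ne_zero _ X_ne_zero
    refine ⟨(-1 + a * k) ^ 2 - (1 + a * f) ^ 2 + 4 * a * (3 * x₀ - 1) + 4 * a * X ^ n,
      mul_left_cancel₀ hX ?_⟩
    linear_combination -h3 - h
  have hd2 : (x₀ - 1 + a * x₀ * f) ^ 2 = 4 * a * x₀ ^ 2 * (x₀ - 1) := by
    rw [disc, ← hf] at hd0
    linear_combination hd0
  have hA : x₀ - 1 + a * x₀ * f = 2 * a * x₀ ^ 3 :=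
    mul_left_cancel₀ h2 (by linear_combination x₀ * hd1 - 2 * hd2)
  have hx4 : a * x₀ ^ 4 = x₀ - 1 := by
    refine mul_left_cancel₀
      (mul_ne_zero (mul_ne_zero h2 (mul_ne_zero h2 ha0)) (pow_ne_zero 2 hx0)) ?_
    rw [hA] at hd2
    linear_combination hd2
  have hu : (1 - a * x₀ ^ 3) * x₀ = 1 := by linear_combination -hx4
  have hZ0 : a * x₀ ^ 3 ≠ 0 := mul_ne_zero ha0 (pow_ne_zero 3 hx0)
  have haZ : a = a * x₀ ^ 3 * (1 - a * x₀ ^ 3) ^ 3 := by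
    have : ((1 - a * x₀ ^ 3) * x₀) ^ 3 = 1 := by rw [hu, one_pow]
    linear_combination -a * this
  refine ⟨a * x₀ ^ 3, x₀, by simp [ha], hZ0, haZ, ?_, hu, hx4, hk⟩
  have h1 : a * f = a * x₀ ^ 3 * (1 - 2 * (a * x₀ ^ 3)) :=
    mul_left_cancel₀ hx0 (by linear_combination hA + (2 * a * x₀ ^ 3 + 1) * hx4)
  refine mul_left_cancel₀ hZ0 ?_
  linear_combination h1 - f * haZ

end Solution

/-! ### Rational parametrization of `F` and of the kernel -/

section Parametrized

variable {R : Type*} [CommRing R] {a : R⟦X⟧} {ha : constantCoeff a = 0} {Z x₀ : R⟦X⟧}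

/-- Existence of the parameter `u` with `x = (1+u)/(1+Zu)²`. -/
theorem IsParametrization.exists_param (hZ : IsParametrization a ha Z x₀) (x : R⟦X⟧) :
    ∃ u, x * (1 + Z * u) ^ 2 = 1 + u ∧ constantCoeff u = constantCoeff x - 1 := by
  obtain ⟨u, hu⟩ := exists_fixedPoint (x - 1) Z hZ.constantCoeff_eq
    (((CongrPreserving.const x).mul CongrPreserving.id).mul
      ((CongrPreserving.const 2).add ((CongrPreserving.const Z).mul CongrPreserving.id)))
  refine ⟨u, by linear_combination -hu, ?_⟩
  rw [hu]
  simp [hZ.constantCoeff_eq]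

theorem IsParametrization.a_mul_evalF_one (hZ : IsParametrization a ha Z x₀) :
    a * evalF a ha 1 = Z * (1 - 2 * Z) := by
  linear_combination evalF a ha 1 * hZ.eq + Z * hZ.evalF_one

variable [IsDomain R] [CharZero R]

/-- The value of `F(x)` for `x = (1+u)/(1+Zu)²`. The square root of the discriminant is determined
by its constant term after division by `x - x₀`. -/
theorem IsParametrization.evalF_eq (hZ : IsParametrization a ha Z x₀) {x u : R⟦X⟧} (hx : x ≠ 0)
    (hu : x * (1 + Z * u) ^ 2 = 1 + u) :
    evalF a ha x * (1 - Z) ^ 3 = (1 + Z * u) * (1 - 2 * Z - Z ^ 2 * u) := by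
  have hZc := hZ.constantCoeff_eq
  have h2 := two_ne_zero_powerSeries (R := R)
  have hL : 1 + Z * u ≠ 0 := (isUnit_one_add_mul Z hZc u).ne_zero
  have haf := hZ.a_mul_evalF_one
  set β := Z * (1 + u) ^ 2 * (1 - 2 * Z - Z ^ 2 * u) - u * (1 - Z) ^ 3 with hβ
  have hβ' : β = (x - x₀) * ((1 - Z) * (1 + Z * u) ^ 2 * (2 * Z - 1 + Z * u)) := by
    linear_combination (2 * Z - 1 + Z * u) * ((1 + Z * u) ^ 2 * hZ.mul_eq_one - (1 - Z) * hu)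
  have hsq : (discRoot a ha x * (1 + Z * u) ^ 3) ^ 2 = β ^ 2 := by
    have h : disc a ha x * (1 + Z * u) ^ 6 =
        ((1 + Z * (1 - 2 * Z)) * (x * (1 + Z * u) ^ 2) - (1 + Z * u) ^ 2) ^ 2 * (1 + Z * u) ^ 2 -
          4 * (Z * (1 - Z) ^ 3) * (x * (1 + Z * u) ^ 2) ^ 2 *
            (x * (1 + Z * u) ^ 2 - (1 + Z * u) ^ 2) := by
      rw [disc, mul_right_comm a x, haf, ← hZ.eq]
      ring
    rw [mul_pow, discRoot_sq, ← pow_mul, h, hu, hβ]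
    ring
  have hroot : discRoot a ha x * (1 + Z * u) ^ 3 = β := by
    obtain ⟨k, hk⟩ := hZ.discRoot_eq x
    rcases sq_eq_sq_iff_eq_or_eq_neg.1 hsq with h | h
    · exact h
    · by_cases hxx : x = x₀
      · rw [hk, hβ', hxx]
        ring
      · exfalso
        rw [hk, hβ', mul_assoc, ← mul_neg] at h
        have := congrArg (constantCoeff (R := R)) (mul_left_cancel₀ (sub_ne_zero.2 hxx) h)
        simp only [map_mul, map_add, map_neg, map_one, ha, hZc, map_pow, map_sub, map_ofNat] at this
        have h3 : (2 : R) = 0 := by linear_combination -this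
        exact two_ne_zero h3
  have hne : 2 * (Z * x ^ 2 * (1 + Z * u) ^ 4) ≠ 0 :=
    mul_ne_zero h2 (mul_ne_zero (mul_ne_zero hZ.ne_zero (pow_ne_zero 2 hx)) (pow_ne_zero 4 hL))
  refine mul_left_cancel₀ hne ?_
  rw [discRoot] at hroot
  have h1 : 2 * (Z * x ^ 2 * (1 + Z * u) ^ 4) * (evalF a ha x * (1 - Z) ^ 3) =
      (β + ((1 + Z * (1 - 2 * Z)) * (x * (1 + Z * u) ^ 2) - (1 + Z * u) ^ 2) * (1 + Z * u)) *
        (1 + Z * u) := by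
    linear_combination (1 + Z * u) * hroot + x * (1 + Z * u) ^ 4 * haf -
      2 * x ^ 2 * (1 + Z * u) ^ 4 * evalF a ha x * hZ.eq
  have h3 : 2 * (Z * x ^ 2 * (1 + Z * u) ^ 4) * ((1 + Z * u) * (1 - 2 * Z - Z ^ 2 * u)) =
      2 * Z * (x * (1 + Z * u) ^ 2) ^ 2 * ((1 + Z * u) * (1 - 2 * Z - Z ^ 2 * u)) := by ring
  rw [h1, h3, hu, hβ]
  ring

/-- On the kernel, `u` is a rational function of `v`, where `x = (1+u)/(1+Zu)²` and
`y = (1+v)/(1+Zv)²`. -/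
theorem IsParametrization.kernel_eq (hZ : IsParametrization a ha Z x₀) {x y u v : R⟦X⟧}
    (hx : x ≠ 0) (hy : y ≠ 0) (hu : x * (1 + Z * u) ^ 2 = 1 + u)
    (hv : y * (1 + Z * v) ^ 2 = 1 + v)
    (hK : x - 1 = a * x ^ 2 * evalF a ha x * evalF a ha y) :
    Z * (1 + Z * v) * (1 + u) = (1 - Z) ^ 2 * u := by
  have hZc := hZ.constantCoeff_eq
  have hFx := hZ.evalF_eq hx hu
  have hFy := hZ.evalF_eq hy hv
  have hL : (1 + Z * u) * (1 - 2 * Z - Z ^ 2 * u) ≠ 0 :=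
    ne_zero_of_constantCoeff (by simp [hZc])
  have h1 : u * (1 + Z * u) * (1 - Z) ^ 3 =
      Z * (1 + u) ^ 2 * ((1 + Z * v) * (1 - 2 * Z - Z ^ 2 * v)) := by
    refine mul_left_cancel₀ hL ?_
    have e1 : (x - 1) * (1 + Z * u) ^ 2 = u * (1 - 2 * Z - Z ^ 2 * u) := by
      linear_combination hu
    have e2 : a * x ^ 2 * evalF a ha x * evalF a ha y * (1 + Z * u) ^ 4 * (1 - Z) ^ 3 =
        Z * (x * (1 + Z * u) ^ 2) ^ 2 * (evalF a ha x * (1 - Z) ^ 3) *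
          (evalF a ha y * (1 - Z) ^ 3) := by
      linear_combination (x ^ 2 * evalF a ha x * evalF a ha y * (1 + Z * u) ^ 4 *
        (1 - Z) ^ 3) * hZ.eq
    rw [hu, hFx, hFy, ← hK] at e2
    linear_combination e2 - (1 + Z * u) ^ 2 * (1 - Z) ^ 3 * e1
  -- The equation factors; the other factor is excluded by its constant term.
  have h2 : ((1 + Z * v) * (Z * (1 + u)) - (1 - Z) * (1 + Z * u)) *
      (Z * (Z * (1 + Z * v) * (1 + u)) - Z * ((1 - Z) ^ 2 * u)) = 0 := by
    linear_combination Z * h1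
  have h3 : (1 + Z * v) * (Z * (1 + u)) - (1 - Z) * (1 + Z * u) ≠ 0 :=
    ne_zero_of_constantCoeff (by simp [hZc])
  exact mul_left_cancel₀ hZ.ne_zero (sub_eq_zero.1 ((mul_eq_zero.1 h2).resolve_left h3))

end Parametrized

/-! ### The kernel method -/

section Kernel

variable {R : Type*} [CommRing R] (a : R⟦X⟧) (ha : constantCoeff a = 0)

/-- The root `ξ y` of the first kernel. -/
theorem exists_kernel_root : ∃ ξ : R⟦X⟧ → R⟦X⟧, CongrPreserving ξ ∧
    ∀ y, ξ y - 1 = a * ξ y ^ 2 * evalF a ha (ξ y) * evalF a ha y := by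
  obtain ⟨ξ, hξ, h⟩ := exists_fixedPoint_param 1 a ha
    (CongrPreserving.id.mul (CongrPreserving.id.mul (congrPreserving_evalF a ha)))
    (congrPreserving_evalF a ha)
  exact ⟨ξ, hξ, fun y => by linear_combination h y⟩

theorem constantCoeff_eq_one_of_sub_one_eq {R : Type*} [CommRing R] (a : R⟦X⟧)
    (ha : constantCoeff a = 0) {x k : R⟦X⟧} (h : x - 1 = a * k) :
    constantCoeff x = 1 := by
  rw [sub_eq_iff_eq_add.1 h]
  simp [ha]

variable [IsDomain R]

/-- The first kernel cancels `G(x, y)` and relates `G(1, y)` to `G(1, 1)`. -/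
theorem evalG_one_equation (ha0 : a ≠ 0) {x : R⟦X⟧} (y w : R⟦X⟧)
    (hK : x - 1 = a * x ^ 2 * evalF a ha x * evalF a ha y) :
    (y - 1) * (x * evalF a ha x * (evalF a ha y - 1) + y * evalF a ha y - evalG a ha 1 y w) +
      a * w * x * y * evalF a ha x * evalF a ha y * (evalG a ha 1 y w - evalG a ha 1 1 w) = 0 := by
  have hx : constantCoeff x = 1 := constantCoeff_eq_one_of_sub_one_eq a ha
    (k := x ^ 2 * evalF a ha x * evalF a ha y) (by linear_combination hK)
  have hx1 : x - 1 ≠ 0 := by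
    rw [hK, mul_assoc, mul_assoc]
    exact mul_ne_zero ha0 (ne_zero_of_constantCoeff (by simp [hx]))
  refine mul_left_cancel₀ hx1 ?_
  linear_combination -evalG_kernel_equation a ha x y w +
    (y - 1) * (evalG a ha x y w - evalG a ha 1 y w) * hK

/-- The second kernel determines `G(1, 1)`. -/
theorem exists_evalG_one_one_eq (ha0 : a ≠ 0) (w : R⟦X⟧) (hw : w ≠ 0) :
    ∃ x y : R⟦X⟧, x - 1 = a * x ^ 2 * evalF a ha x * evalF a ha y ∧
      y - 1 = a * w * x * y * evalF a ha x * evalF a ha y ∧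
      evalG a ha 1 1 w = x * evalF a ha x * (evalF a ha y - 1) + y * evalF a ha y := by
  obtain ⟨ξ, hξ, hK⟩ := exists_kernel_root a ha
  have hF := congrPreserving_evalF a ha
  obtain ⟨y, hy⟩ := exists_fixedPoint 1 a ha
    ((((CongrPreserving.const w).mul hξ).mul CongrPreserving.id).mul (hF.comp hξ) |>.mul hF)
  have hy' : y - 1 = a * w * ξ y * y * evalF a ha (ξ y) * evalF a ha y := by
    linear_combination hy
  have hx : constantCoeff (ξ y) = 1 := constantCoeff_eq_one_of_sub_one_eq a ha
    (k := ξ y ^ 2 * evalF a ha (ξ y) * evalF a ha y) (by linear_combination hK y)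
  have hyc : constantCoeff y = 1 := constantCoeff_eq_one_of_sub_one_eq a ha
    (k := w * ξ y * y * evalF a ha (ξ y) * evalF a ha y) (by linear_combination hy')
  have hy1 : y - 1 ≠ 0 := by
    have : y - 1 = a * w * (ξ y * y * evalF a ha (ξ y) * evalF a ha y) := by
      linear_combination hy'
    rw [this]
    exact mul_ne_zero (mul_ne_zero ha0 hw) (ne_zero_of_constantCoeff (by simp [hx, hyc]))
  refine ⟨ξ y, y, hK y, hy', ?_⟩
  refine mul_left_cancel₀ hy1 ?_
  linear_combination -evalG_one_equation a ha ha0 y w (hK y) -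
    (evalG a ha 1 y w - evalG a ha 1 1 w) * hy'

end Kernel

/-! ### The cubic equation -/

section Cubic

/-- The cubic relation, once `w` and `h` are expressed as rational functions of `z` and `s`. -/
theorem cubic_eq_zero_of_param {k : Type*} [Field k] {z s w h : k} (hz : z ≠ 0) (hc : 1 - z ≠ 0)
    (hs : s ≠ 0) (h1 : 1 - z - z * s ≠ 0) (h2 : 1 - z - z - z * s ≠ 0) (h3 : s - (1 - z) ≠ 0)
    (hw : w * (z * (s - (1 - z)) * s * (1 - z - z - z * s)) =
      (s - 1) * ((1 - z) ^ 2 - z * s) * (1 - z - z * s))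
    (hh : h = (s - (1 - z)) / (1 - z) ^ 3 *
      ((1 - z - z * s) / (z * s) + (1 - z - z - z * s) / (1 - z - z * s))) :
    cubic h z w = 0 := by
  have hw' : w = (s - 1) * ((1 - z) ^ 2 - z * s) * (1 - z - z * s) /
      (z * (s - (1 - z)) * s * (1 - z - z - z * s)) := by
    rw [eq_div_iff, hw]
    exact mul_ne_zero (mul_ne_zero (mul_ne_zero hz h3) hs) h2
  -- In terms of `(1 - z)³ h`, the denominators are much smaller.
  obtain ⟨m, hm⟩ : ∃ m, m = (1 - z) ^ 3 * h := ⟨_, rfl⟩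
  have hm' : m = (s - (1 - z)) * ((1 - z - z * s) ^ 2 + z * s * (1 - z - z - z * s)) /
      (z * s * (1 - z - z * s)) := by
    rw [hm, hh]
    field_simp
  have e : cubic h z w = -(w * z * m ^ 3) +
      (2 * w ^ 2 * z ^ 2 - w ^ 2 * z + 2 * z ^ 2 + w - z) * m ^ 2 +
      (w ^ 2 * z ^ 3 - 3 * w ^ 2 * z ^ 2 - 2 * w * z ^ 3 + w ^ 2 * z - 2 * w * z ^ 2 + z ^ 3 +
        5 * w * z - 3 * z ^ 2 - 2 * w + z) * m + 4 * w * z ^ 2 - 4 * w * z + w := by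
    rw [hm, cubic]
    ring
  rw [e, hm', hw']
  clear e hm hm' hw hw' hh
  have key : ∀ D E N M : k, D ≠ 0 → E ≠ 0 →
      -(N * z * M ^ 3) * D + (2 * N ^ 2 * z ^ 2 - N ^ 2 * z + (2 * z ^ 2 - z) * D ^ 2 + N * D) *
        M ^ 2 * E + ((N ^ 2 * (z ^ 3 - 3 * z ^ 2 + z) +
        N * D * (-2 * z ^ 3 - 2 * z ^ 2 + 5 * z - 2) + D ^ 2 * (z ^ 3 - 3 * z ^ 2 + z)) *
        M * E ^ 2 +
        N * D * (4 * z ^ 2 - 4 * z + 1) * E ^ 3) = 0 →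
      -(N / D * z * (M / E) ^ 3) +
      (2 * (N / D) ^ 2 * z ^ 2 - (N / D) ^ 2 * z + 2 * z ^ 2 + N / D - z) * (M / E) ^ 2 +
      ((N / D) ^ 2 * z ^ 3 - 3 * (N / D) ^ 2 * z ^ 2 - 2 * (N / D) * z ^ 3 + (N / D) ^ 2 * z -
        2 * (N / D) * z ^ 2 + z ^ 3 + 5 * (N / D) * z - 3 * z ^ 2 - 2 * (N / D) + z) * (M / E) +
        4 * (N / D) * z ^ 2 - 4 * (N / D) * z + N / D = 0 := by
    intro D E N M hD hE h
    have hDE : D ^ 2 * E ^ 3 ≠ 0 := mul_ne_zero (pow_ne_zero 2 hD) (pow_ne_zero 3 hE)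
    refine mul_left_cancel₀ hDE ?_
    rw [mul_zero, ← h]
    field_simp
    ring
  refine key _ _ _ _ (mul_ne_zero (mul_ne_zero (mul_ne_zero hz h3) hs) h2)
    (mul_ne_zero (mul_ne_zero hz hs) h1) ?_
  ring

/-- Elimination of `u` and `v` from the parametrized kernel equations; here `A = F(x)` and
`B = F(y)`. -/
theorem cubic_eq_zero_of_kernels {k : Type*} [Field k] {z w x y u v A B h : k} (hz : z ≠ 0)
    (hc : 1 - z ≠ 0) (hr : 1 + z * u ≠ 0) (hs : 1 + z * v ≠ 0) (hu1 : 1 - 2 * z - z ^ 2 * u ≠ 0)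
    (hv1 : 1 - 2 * z - z ^ 2 * v ≠ 0) (hv2 : 1 + v ≠ 0) (hd : (1 - z) ^ 2 - z * (1 + z * v) ≠ 0)
    (hx : x * (1 + z * u) ^ 2 = 1 + u) (hy : y * (1 + z * v) ^ 2 = 1 + v)
    (hA : A * (1 - z) ^ 3 = (1 + z * u) * (1 - 2 * z - z ^ 2 * u))
    (hB : B * (1 - z) ^ 3 = (1 + z * v) * (1 - 2 * z - z ^ 2 * v))
    (huv : z * (1 + z * v) * (1 + u) = (1 - z) ^ 2 * u)
    (hyw : y - 1 = z * (1 - z) ^ 3 * w * x * y * A * B)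
    (hh : h = x * A * (B - 1) + y * B) : cubic h z w = 0 := by
  obtain ⟨s, hs'⟩ : ∃ s, s = 1 + z * v := ⟨_, rfl⟩
  have hv : 1 - 2 * z - z ^ 2 * v = 1 - z - z * s := by rw [hs']; ring
  have hvs : 1 + v = (s - (1 - z)) / z := by rw [hs']; field_simp; ring
  rw [hv] at hv1 hB
  rw [← hs'] at hs hd hy hB huv
  set d := (1 - z) ^ 2 - z * s with hd'
  have e1 : 1 + u = (1 - z) ^ 2 / d := by
    rw [eq_div_iff hd]
    linear_combination -huv
  have e2 : 1 + z * u = (1 - z) * (1 - z - z * s) / d := by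
    rw [eq_div_iff hd]
    linear_combination -z * huv
  have e3 : 1 - 2 * z - z ^ 2 * u = (1 - z) ^ 2 * (1 - z - z - z * s) / d := by
    rw [eq_div_iff hd]
    linear_combination z ^ 2 * huv
  have h2 : 1 - z - z - z * s ≠ 0 := by
    intro h0
    rw [e3, h0, mul_zero, zero_div] at hu1
    exact hu1 rfl
  have h3 : s - (1 - z) ≠ 0 := by
    intro h0
    rw [hvs, h0, zero_div] at hv2
    exact hv2 rfl
  have hB' : B = s * (1 - z - z * s) / (1 - z) ^ 3 := by rw [eq_div_iff (pow_ne_zero 3 hc), hB]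
  have hyB : y * B = (s - (1 - z)) * (1 - z - z * s) / (z * s * (1 - z) ^ 3) := by
    have : y = (s - (1 - z)) / z / s ^ 2 := by rw [eq_div_iff (pow_ne_zero 2 hs), hy, hvs]
    rw [this, hB']
    field_simp
  have hxA : x * A = (1 - z - z - z * s) / (d * (1 - z - z * s)) := by
    have h4 : A = (1 + z * u) * (1 - 2 * z - z ^ 2 * u) / (1 - z) ^ 3 := by
      rw [eq_div_iff (pow_ne_zero 3 hc), hA]
    have h5 : x = (1 + u) / (1 + z * u) ^ 2 := by rw [eq_div_iff (pow_ne_zero 2 hr), hx]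
    rw [h4, h5, e1, e2, e3]
    field_simp
  refine cubic_eq_zero_of_param hz hc hs hv1 h2 h3 ?_ ?_
  · have h6 : y - 1 = z * (1 - z) ^ 3 * w * (x * A) * (y * B) := by rw [hyw]; ring
    have h7 : (y - 1) * s ^ 2 = (s - 1) / z * (1 - z - z * s) := by
      have : (y - 1) * s ^ 2 = 1 + v - s ^ 2 := by linear_combination hy
      rw [this, hvs]
      field_simp
      ring
    rw [h6, hxA, hyB] at h7
    rw [← hd']
    field_simp at h7
    linear_combination h7
  · have h8 : B - 1 = (s - (1 - z)) * d / (1 - z) ^ 3 := by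
      rw [hB', eq_div_iff (pow_ne_zero 3 hc), sub_mul, div_mul_cancel₀ _ (pow_ne_zero 3 hc), hd']
      ring
    rw [hh, hxA, h8, hyB]
    field_simp
    ring

theorem map_cubic {R S : Type*} [CommRing R] [CommRing S] (f : R →+* S) (h z w : R) :
    f (cubic h z w) = cubic (f h) (f z) (f w) := by
  simp only [cubic, map_add, map_sub, map_mul, map_pow, map_neg, map_one, map_ofNat]

theorem IsParametrization.cubic_evalG {R : Type*} [CommRing R] [IsDomain R] [CharZero R]
    {a : R⟦X⟧} {ha : constantCoeff a = 0} {Z x₀ : R⟦X⟧} (hZ : IsParametrization a ha Z x₀)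
    (ha0 : a ≠ 0) {w : R⟦X⟧} (hw : w ≠ 0) : cubic (evalG a ha 1 1 w) Z w = 0 := by
  obtain ⟨x, y, hK, hyw, hh⟩ := exists_evalG_one_one_eq a ha ha0 w hw
  have hZc := hZ.constantCoeff_eq
  have hxc : constantCoeff x = 1 := constantCoeff_eq_one_of_sub_one_eq a ha
    (k := x ^ 2 * evalF a ha x * evalF a ha y) (by linear_combination hK)
  have hyc : constantCoeff y = 1 := constantCoeff_eq_one_of_sub_one_eq a ha
    (k := w * x * y * evalF a ha x * evalF a ha y) (by linear_combination hyw)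
  have hx0 : x ≠ 0 := ne_zero_of_constantCoeff (by simp [hxc])
  have hy0 : y ≠ 0 := ne_zero_of_constantCoeff (by simp [hyc])
  obtain ⟨u, hu, huc⟩ := hZ.exists_param x
  obtain ⟨v, hv, hvc⟩ := hZ.exists_param y
  have hA := hZ.evalF_eq hx0 hu
  have hB := hZ.evalF_eq hy0 hv
  have huv := hZ.kernel_eq hx0 hy0 hu hv hK
  rw [hxc, sub_self] at huc
  rw [hyc, sub_self] at hvc
  have hyw' : y - 1 = Z * (1 - Z) ^ 3 * w * x * y * evalF a ha x * evalF a ha y := by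
    rw [← hZ.eq, hyw]
  set φ := algebraMap R⟦X⟧ (FractionRing R⟦X⟧) with hφ
  have hinj : Function.Injective φ := IsFractionRing.injective _ _
  have hmap : ∀ {p q : R⟦X⟧}, p = q → φ p = φ q := fun h => congrArg φ h
  have hne : ∀ p : R⟦X⟧, constantCoeff p ≠ 0 → φ p ≠ 0 := fun p hp =>
    (map_ne_zero_iff φ hinj).2 (ne_zero_of_constantCoeff hp)
  refine hinj ?_
  rw [map_zero, map_cubic]
  refine cubic_eq_zero_of_kernels (x := φ x) (y := φ y) (u := φ u) (v := φ v)
    (A := φ (evalF a ha x)) (B := φ (evalF a ha y)) ((map_ne_zero_iff φ hinj).2 hZ.ne_zero)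
    ?_ ?_ ?_ ?_ ?_ ?_ ?_ ?_ ?_ ?_ ?_ ?_ ?_ ?_
  · simpa only [map_add, map_sub, map_mul, map_pow, map_one, map_ofNat]
      using hne (1 - Z) (by simp [hZc])
  · simpa only [map_add, map_sub, map_mul, map_pow, map_one, map_ofNat]
      using hne (1 + Z * u) (by simp [hZc])
  · simpa only [map_add, map_sub, map_mul, map_pow, map_one, map_ofNat]
      using hne (1 + Z * v) (by simp [hZc])
  · have h := hne (1 - 2 * Z - Z ^ 2 * u) (by simp [hZc])
    rw [map_sub] at h
    simpa only [map_add, map_sub, map_mul, map_pow, map_one, map_ofNat] using h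
  · have h := hne (1 - 2 * Z - Z ^ 2 * v) (by simp [hZc])
    rw [map_sub] at h
    simpa only [map_add, map_sub, map_mul, map_pow, map_one, map_ofNat] using h
  · simpa only [map_add, map_sub, map_mul, map_pow, map_one, map_ofNat]
      using hne (1 + v) (by simp [hvc])
  · have h := hne ((1 - Z) ^ 2 - Z * (1 + Z * v)) (by simp [hZc])
    rw [map_sub] at h
    simpa only [map_add, map_sub, map_mul, map_pow, map_one, map_ofNat] using h
  · simpa only [map_add, map_sub, map_mul, map_pow, map_one, map_ofNat] using hmap hu
  · simpa only [map_add, map_sub, map_mul, map_pow, map_one, map_ofNat] using hmap hv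
  · simpa only [map_add, map_sub, map_mul, map_pow, map_one, map_ofNat] using hmap hA
  · simpa only [map_add, map_sub, map_mul, map_pow, map_one, map_ofNat] using hmap hB
  · simpa only [map_add, map_sub, map_mul, map_pow, map_one, map_ofNat] using hmap huv
  · simpa only [map_add, map_sub, map_mul, map_pow, map_one, map_ofNat] using hmap hyw'
  · simpa only [map_add, map_sub, map_mul, map_pow, map_one, map_ofNat] using hmap hh

end Cubic

/-! ### Transfer to the series `G(x, y)` -/

section Transfer

variable {R : Type*} [CommRing R]

theorem map_G {S : Type*} [CommRing S] (f : R →+* S) (x y w : R) :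
    PowerSeries.map f (G x y w) = G (f x) (f y) (f w) := by
  ext n
  simp [G, map_sum]

theorem evalG_C (a : R⟦X⟧) (ha : constantCoeff a = 0) (x y w : R) :
    evalG a ha (C x) (C y) (C w) = (G x y w).subst a := by
  rw [evalG, ← map_G, evalHom_map_C]

theorem evalG_X_C (x y w : R) :
    evalG X constantCoeff_X (C x) (C y) (C w) = G x y w := by
  rw [evalG_C, ← map_algebraMap_eq_subst_X]
  simp

/-- `t = z(1-z)³` determines `z`. -/
theorem eq_of_mul_one_sub_pow_eq [IsDomain R] {Z Z' : R⟦X⟧} (hZ : constantCoeff Z = 0)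
    (hZ' : constantCoeff Z' = 0) (h : Z * (1 - Z) ^ 3 = Z' * (1 - Z') ^ 3) : Z = Z' := by
  have h1 : (1 - 3 * (Z + Z') + 3 * (Z ^ 2 + Z * Z' + Z' ^ 2) -
      (Z ^ 3 + Z ^ 2 * Z' + Z * Z' ^ 2 + Z' ^ 3)) ≠ 0 :=
    ne_zero_of_constantCoeff (by simp [hZ, hZ'])
  exact sub_eq_zero.1 ((mul_eq_zero.1 (by linear_combination h)).resolve_left h1)

theorem cubic_subst_G [IsDomain R] [CharZero R] {w : R} (hw : w ≠ 0) :
    cubic ((G 1 1 w).subst (tOfZ R)) (X : R⟦X⟧) (C w) = 0 := by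
  have ha : constantCoeff (tOfZ R) = 0 := by simp [tOfZ]
  have ha0 : tOfZ R ≠ 0 := by
    refine mul_ne_zero X_ne_zero (pow_ne_zero 3 (ne_zero_of_constantCoeff ?_))
    simp
  obtain ⟨Z, x₀, hZ⟩ := exists_isParametrization (tOfZ R) ha ha0
  have hZX : Z = X := eq_of_mul_one_sub_pow_eq hZ.constantCoeff_eq constantCoeff_X
    (hZ.eq.symm.trans rfl)
  subst hZX
  have hw' : (C w : R⟦X⟧) ≠ 0 := ne_zero_of_constantCoeff (by simpa using hw)
  have h := hZ.cubic_evalG ha0 hw'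
  rwa [← map_one (C (R := R)), evalG_C] at h

end Transfer

/-! ### Algebraicity -/

section Algebraic

/-- A root of a quartic polynomial with algebraic coefficients is algebraic. The polynomial is
nonzero because of its linear coefficient, which is the easiest one to control for power series. -/
theorem mem_algebraicClosure_of_quartic {A S : Type*} [CommRing A] [IsDomain A] [CommRing S]
    [IsDomain S] [Algebra A S] (g : S) (e₄ e₃ e₂ e₁ e₀ : Subalgebra.algebraicClosure A S)
    (h₁ : (e₁ : S) ≠ 0)
    (h : (e₄ : S) * g ^ 4 + e₃ * g ^ 3 + e₂ * g ^ 2 + e₁ * g + e₀ = 0) :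
    ∃ b : Subalgebra.algebraicClosure A S, (b : S) = g := by
  have : IsAlgebraic (Subalgebra.algebraicClosure A S) g := by
    refine ⟨Polynomial.C e₄ * Polynomial.X ^ 4 + Polynomial.C e₃ * Polynomial.X ^ 3 +
      Polynomial.C e₂ * Polynomial.X ^ 2 + Polynomial.C e₁ * Polynomial.X + Polynomial.C e₀,
      fun h0 => h₁ ?_, ?_⟩
    · have := congrArg (fun p => Polynomial.coeff p 1) h0
      simpa [Polynomial.coeff_X, Polynomial.coeff_C] using congrArg Subtype.val this
    · simpa [Subalgebra.algebraMap_def] using h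
  exact ⟨⟨g, this.restrictScalars A⟩, rfl⟩

variable {R : Type*} [CommRing R] [IsDomain R] [CharZero R]

theorem isAlgebraic_G {x y w : R} (hx : x ≠ 1) (hy0 : y ≠ 0) (hy : y ≠ 1) (hw : w ≠ 0) :
    IsAlgebraic (Polynomial R) (G x y w) := by
  obtain ⟨t, ht⟩ : ∃ b : Subalgebra.algebraicClosure (Polynomial R) R⟦X⟧, (b : R⟦X⟧) = X :=
    ⟨⟨X, by
      have h := isAlgebraic_algebraMap (A := R⟦X⟧) (Polynomial.X : Polynomial R)
      rw [PowerSeries.algebraMap_apply'] at h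
      exact (Subalgebra.mem_algebraicClosure _ _).2 (by simpa using h)⟩, rfl⟩
  have hC : ∀ r : R, ∃ b : Subalgebra.algebraicClosure (Polynomial R) R⟦X⟧, (b : R⟦X⟧) = C r :=
    fun r => ⟨⟨C r, by
      have h := isAlgebraic_algebraMap (A := R⟦X⟧) (Polynomial.C r)
      rw [PowerSeries.algebraMap_apply'] at h
      exact (Subalgebra.mem_algebraicClosure _ _).2 (by simpa using h)⟩, rfl⟩
  have hn : ∀ (n : ℕ) [n.AtLeastTwo],
      ((OfNat.ofNat n : Subalgebra.algebraicClosure (Polynomial R) R⟦X⟧) : R⟦X⟧) = OfNat.ofNat n :=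
    fun n _ => map_ofNat (Subalgebra.algebraicClosure (Polynomial R) R⟦X⟧).val n
  have c2 := hn 2
  have c3 := hn 3
  have c4 := hn 4
  have c5 := hn 5
  obtain ⟨x', hx'⟩ := hC x
  obtain ⟨y', hy'⟩ := hC y
  obtain ⟨w', hw'⟩ := hC w
  have ha := constantCoeff_X (R := R)
  have hX0 : (X : R⟦X⟧) ≠ 0 := X_ne_zero
  obtain ⟨Z, x₀, hZ⟩ := exists_isParametrization X ha hX0
  have hZc := hZ.constantCoeff_eq
  have hx1 : x - 1 ≠ 0 := sub_ne_zero.2 hx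
  have hy1 : y - 1 ≠ 0 := sub_ne_zero.2 hy
  -- The series attached to `F`.
  obtain ⟨x₀', hx₀⟩ := mem_algebraicClosure_of_quartic x₀ t 0 0 (-1) 1 (by simp) (by
    push_cast [c2, c3, c4, c5]
    linear_combination hZ.root_eq + x₀ ^ 4 * ht)
  obtain ⟨Z', hZ'⟩ := mem_algebraicClosure_of_quartic Z 0 0 0 x₀' (1 - x₀')
    (by rw [hx₀]; exact right_ne_zero_of_mul_eq_one hZ.mul_eq_one) (by
    push_cast [c2, c3, c4, c5]
    linear_combination -hZ.mul_eq_one + (Z - 1) * hx₀)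
  have hF : ∀ z : R, z ≠ 1 → ∃ b : Subalgebra.algebraicClosure (Polynomial R) R⟦X⟧,
      (b : R⟦X⟧) = evalF X ha (C z) := by
    intro z hz
    obtain ⟨z', hz'⟩ := hC z
    refine mem_algebraicClosure_of_quartic _ 0 0 (t * z' ^ 2)
      (-(z' * (Z' * (1 - 2 * Z')) + z' - 1)) (z' - 1) ?_ ?_
    · push_cast [c2, c3, c4, c5]
      rw [hZ', hz']
      refine ne_zero_of_constantCoeff ?_
      simpa [hZc, sub_eq_zero] using hz.symm
    · push_cast [c2, c3, c4, c5]
      rw [ht, hz', hZ', ← hZ.a_mul_evalF_one]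
      linear_combination -evalF_equation X ha (C z)
  obtain ⟨A, hA⟩ := hF x hx
  obtain ⟨B, hB⟩ := hF y hy
  -- The root `p` of the first kernel, through its parameter `u`.
  obtain ⟨ξ, -, hξ⟩ := exists_kernel_root X ha
  have hK := hξ (C y)
  set p := ξ (C y) with hp
  have hpc : constantCoeff p = 1 := constantCoeff_eq_one_of_sub_one_eq X ha
    (k := p ^ 2 * evalF X ha p * evalF X ha (C y)) (by linear_combination hK)
  have hp0 : p ≠ 0 := ne_zero_of_constantCoeff (by simp [hpc])
  have hCy0 : (C y : R⟦X⟧) ≠ 0 := ne_zero_of_constantCoeff (by simpa using hy0)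
  obtain ⟨u, hu, huc⟩ := hZ.exists_param p
  obtain ⟨v, hv, -⟩ := hZ.exists_param (C y)
  have huv := hZ.kernel_eq hp0 hCy0 hu hv hK
  obtain ⟨v', hv'⟩ := mem_algebraicClosure_of_quartic v 0 0 (y' * Z' ^ 2) (2 * y' * Z' - 1) (y' - 1)
    (by push_cast [c2, c3, c4, c5]; rw [hZ', hy']; exact ne_zero_of_constantCoeff (by simp [hZc]))
    (by push_cast [c2, c3, c4, c5]; rw [hZ', hy']; linear_combination hv)
  obtain ⟨u', hu'⟩ := mem_algebraicClosure_of_quartic u 0 0 0 ((1 - Z') ^ 2 - Z' * (1 + Z' * v'))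
    (-(Z' * (1 + Z' * v')))
    (by push_cast [c2, c3, c4, c5]; rw [hZ', hv']; exact ne_zero_of_constantCoeff (by simp [hZc]))
    (by push_cast [c2, c3, c4, c5]; rw [hZ', hv']; linear_combination -huv)
  obtain ⟨p', hp'⟩ := mem_algebraicClosure_of_quartic p 0 0 0 ((1 + Z' * u') ^ 2) (-(1 + u'))
    (by push_cast [c2, c3, c4, c5]; rw [hZ', hu']; exact ne_zero_of_constantCoeff (by simp [hZc]))
    (by push_cast [c2, c3, c4, c5]; rw [hZ', hu']; linear_combination hu)
  obtain ⟨D, hD⟩ := mem_algebraicClosure_of_quartic (evalF X ha p) 0 0 0 ((1 - Z') ^ 3)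
    (-((1 + Z' * u') * (1 - 2 * Z' - Z' ^ 2 * u')))
    (by push_cast [c2, c3, c4, c5]; rw [hZ']; exact ne_zero_of_constantCoeff (by simp [hZc]))
    (by push_cast [c2, c3, c4, c5]; rw [hZ', hu']; linear_combination hZ.evalF_eq hp0 hu)
  -- `G(1, 1)`, through its cubic equation.
  have hCw0 : (C w : R⟦X⟧) ≠ 0 := ne_zero_of_constantCoeff (by simpa using hw)
  have hcub := hZ.cubic_evalG hX0 hCw0
  obtain ⟨h', hh'⟩ := mem_algebraicClosure_of_quartic (evalG X ha 1 1 (C w)) 0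
    (w' * Z' * (-1 + Z') ^ 9)
    ((-1 + Z') ^ 6 * (2 * w' ^ 2 * Z' ^ 2 - w' ^ 2 * Z' + 2 * Z' ^ 2 + w' - Z'))
    (-((-1 + Z') ^ 3 * (w' ^ 2 * Z' ^ 3 - 3 * w' ^ 2 * Z' ^ 2 - 2 * w' * Z' ^ 3 + w' ^ 2 * Z'
        - 2 * w' * Z' ^ 2 + Z' ^ 3 + 5 * w' * Z' - 3 * Z' ^ 2 - 2 * w' + Z')))
    (4 * w' * Z' ^ 2 - 4 * w' * Z' + w')
    (by
      push_cast [c2, c3, c4, c5]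
      rw [hZ', hw']
      refine ne_zero_of_constantCoeff ?_
      simpa [hZc, map_ofNat] using hw)
    (by
      push_cast [c2, c3, c4, c5]
      rw [hZ', hw']
      rw [cubic] at hcub
      linear_combination hcub)
  -- The linear equations for `G(1, y)` and `G(x, y)`.
  have hone := evalG_one_equation X ha hX0 (C y) (C w) hK
  obtain ⟨k, hk⟩ := mem_algebraicClosure_of_quartic (evalG X ha 1 (C y) (C w)) 0 0 0
    (-(y' - 1) + t * w' * p' * y' * D * B)
    ((y' - 1) * (p' * D * (B - 1) + y' * B) - t * w' * p' * y' * D * B * h')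
    (by
      push_cast [c2, c3, c4, c5]
      rw [ht, hy']
      refine ne_zero_of_constantCoeff ?_
      simpa [sub_eq_zero] using hy.symm)
    (by
      push_cast [c2, c3, c4, c5]
      rw [ht, hw', hp', hy', hD, hB, hh']
      linear_combination hone)
  obtain ⟨g, hg⟩ := mem_algebraicClosure_of_quartic (evalG X ha (C x) (C y) (C w)) 0 0 0
    ((y' - 1) * (x' - 1 - t * x' ^ 2 * A * B))
    (-((x' - 1) * (y' - 1) * (x' * A * (B - 1) + y' * B) +
      t * w' * x' * y' * (x' - 1) * A * B * (k - h') - t * x' ^ 2 * (y' - 1) * A * B * k))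
    (by
      push_cast [c2, c3, c4, c5]
      rw [ht, hy', hx']
      refine ne_zero_of_constantCoeff ?_
      simpa using ⟨hy1, hx1⟩)
    (by
      push_cast [c2, c3, c4, c5]
      rw [ht, hw', hx', hy', hA, hB, hh', hk]
      linear_combination evalG_kernel_equation X ha (C x) (C y) (C w))
  rw [← evalG_X_C, ← hg]
  exact g.2

end Algebraic

end TamariHeight

/-- With `x`, `y`, `w` the three indeterminates of `ℚ[x,y,w]`, the series `G(x,y)` in
`ℚ[x,y,w]⟦t⟧` is algebraic over `ℚ[x,y,w][t]`. The series `h(z)` in `ℚ[w]⟦z⟧` obtained from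
`G(1,1)` in `ℚ[w]⟦t⟧` by the substitution `t = z(1-z)^3` satisfies `C(h(z),z,w) = 0`. -/
theorem mainTheorem7 :
    IsAlgebraic (Polynomial (MvPolynomial (Fin 3) ℚ))
      (TamariHeight.G (MvPolynomial.X 0) (MvPolynomial.X 1) (MvPolynomial.X 2) :
        PowerSeries (MvPolynomial (Fin 3) ℚ)) ∧
    TamariHeight.cubic
      (PowerSeries.subst (TamariHeight.tOfZ (Polynomial ℚ))
        (TamariHeight.G 1 1 Polynomial.X : PowerSeries (Polynomial ℚ)))
      (PowerSeries.X : PowerSeries (Polynomial ℚ))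
      (PowerSeries.C Polynomial.X : PowerSeries (Polynomial ℚ)) = 0 := by
  have h1 : ∀ i : Fin 3, (MvPolynomial.X i : MvPolynomial (Fin 3) ℚ) ≠ 1 := fun i h => by
    have := congrArg MvPolynomial.constantCoeff h
    simp at this
  exact ⟨TamariHeight.isAlgebraic_G (h1 0) (MvPolynomial.X_ne_zero 1) (h1 1)
    (MvPolynomial.X_ne_zero 2), TamariHeight.cubic_subst_G Polynomial.X_ne_zero⟩
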